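/- Let $n,m\ge 1$ and let $\gamma$ be an $n\times n$ complex matrix-valued function, analytic in a neighbourhood of the unit circle $S^1$, with $\gamma(z)$ invertible for every $z\in S^1$, and such that the total change of $\arg\det\gamma(e^{i\theta})$ over $0\le\theta\le 2\pi$ is $0$. Write $\gamma(z)=\sum_{k\in\mathbb Z}\gamma^{(k)}z^k$ for its Fourier expansion on $S^1$, let $D_N(\gamma)=\det\big(\gamma^{(i-j)}\big)_{0\le i,j\le N}$ be its block Toeplitz determinants, let $$G(\gamma)=\exp\Big(\frac1{2\pi}\int_0^{2\pi}\log\det\gamma(e^{i\theta})\,d\theta\Big)$$ (with a continuous branch of the logarithm), and let $$D_\infty(\gamma)=\lim_{N\to\infty}\frac{D_N(\gamma)}{G(\gamma)^{N+1}},$$ a limit that exists by the Szegő–Widom theorem. Suppose that $D_\infty(\gamma)\neq 0$. Then for every $C\in\mathbb C^{n\times m}$ the Riemann–Hilbert problem $$\varphi_+(z)=\gamma(z)^{\mathrm T}\varphi_-(z)\quad(z\in S^1),\qquad \varphi_-(\infty)=C,$$ has at most one solution $(\varphi_+,\varphi_-)$, where $\varphi_+$ and $\varphi_-$ are $\mathbb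 C^{n\times m}$-valued, $\varphi_+$ is analytic in $|z|<1$ and continuous on $|z|\le 1$, and $\varphi_-$ is analytic in $|z|>1$, continuous on $|z|\ge 1$, and tends to $C$ as $z\to\infty$. -/

import Mathlib

namespace BlockToeplitz

noncomputable section

/-- The `k`-th Fourier coefficient (a matrix) of the restriction of `γ` to the unit circle:
`γ^(k) = (2πi)⁻¹ ∮ z^(-k-1) γ(z) dz = (2π)⁻¹ ∫ γ(e^{iθ}) e^{-ikθ} dθ`. -/
def laurentCoeff {n : ℕ} (γ : ℂ → Matrix (Fin n) (Fin n) ℂ) (k : ℤ) :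
    Matrix (Fin n) (Fin n) ℂ :=
  Matrix.of fun i j =>
    (2 * (Real.pi : ℂ) * Complex.I)⁻¹ * ∮ z in C(0, 1), z ^ (-k - 1) * γ z i j

/-- The truncated block Toeplitz matrix `T_N(γ)`: its block rows and columns are numbered
`0, …, N`, and the block at `(a, b)` is `γ^(a - b)`. -/
def toeplitzMatrix {n : ℕ} (γ : ℂ → Matrix (Fin n) (Fin n) ℂ) (N : ℕ) :
    Matrix (Fin (N + 1) × Fin n) (Fin (N + 1) × Fin n) ℂ :=
  Matrix.of fun p q => laurentCoeff γ (((p.1 : ℕ) : ℤ) - ((q.1 : ℕ) : ℤ)) p.2 q.2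

/-- The block Toeplitz determinant `D_N(γ)`. -/
def toeplitzDet {n : ℕ} (γ : ℂ → Matrix (Fin n) (Fin n) ℂ) (N : ℕ) : ℂ :=
  (toeplitzMatrix γ N).det

/-- `ℓ` is a continuous branch of `θ ↦ log det γ(e^{iθ})` on `[0, 2π]`. -/
def IsLogDetBranch {n : ℕ} (γ : ℂ → Matrix (Fin n) (Fin n) ℂ) (ℓ : ℝ → ℂ) : Prop :=
  ContinuousOn ℓ (Set.Icc 0 (2 * Real.pi)) ∧
    ∀ θ ∈ Set.Icc (0 : ℝ) (2 * Real.pi),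
      Complex.exp (ℓ θ) = (γ (Complex.exp ((θ : ℂ) * Complex.I))).det

/-- The total change of the argument of `det γ(e^{iθ})` over `0 ≤ θ ≤ 2π` is zero. -/
def ZeroArgVariation {n : ℕ} (γ : ℂ → Matrix (Fin n) (Fin n) ℂ) : Prop :=
  ∃ ℓ : ℝ → ℂ, IsLogDetBranch γ ℓ ∧ (ℓ (2 * Real.pi)).im = (ℓ 0).im

open Classical in
/-- `G(γ) = exp ((2π)⁻¹ ∫₀^{2π} log det γ(e^{iθ}) dθ)`, with a continuous branch of the logarithm
(the value does not depend on the branch, see `geometricMean_eq`). -/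
def geometricMean {n : ℕ} (γ : ℂ → Matrix (Fin n) (Fin n) ℂ) : ℂ :=
  if h : ∃ ℓ : ℝ → ℂ, IsLogDetBranch γ ℓ then
    Complex.exp ((2 * (Real.pi : ℂ))⁻¹ * ∫ θ in (0 : ℝ)..(2 * Real.pi), h.choose θ)
  else 0

/-- The Szegő–Widom constant `D_∞(γ)`: the limit of the block Toeplitz determinants, normalized by
one factor `G(γ)` for each of the `N + 1` block rows of `T_N(γ)`. For smooth invertible loops with
`ZeroArgVariation γ` this limit exists (Szegő–Widom theorem). -/
def szegoWidomConstant {n : ℕ} (γ : ℂ → Matrix (Fin n) (Fin n) ℂ) : ℂ :=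
  Filter.limUnder Filter.atTop fun N : ℕ => toeplitzDet γ N / geometricMean γ ^ (N + 1)

/-- `(φp, φm)` solves the Riemann–Hilbert problem `φ₊ = γᵀ φ₋` on the unit circle, normalized by
`φ₋(∞) = C`. The values are `n × m` matrices: `m = 1` is the case of vectors, `m = n` that of
square matrices. Both functions are analytic on their side of the circle and continuous up to it. -/
structure IsRHSolution {n m : ℕ} (γ : ℂ → Matrix (Fin n) (Fin n) ℂ)
    (C : Matrix (Fin n) (Fin m) ℂ) (φp φm : ℂ → Matrix (Fin n) (Fin m) ℂ) : Prop where
  inside : ∀ i j, DiffContOnCl ℂ (fun z => φp z i j) (Metric.ball 0 1)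
  outside : ∀ i j, DiffContOnCl ℂ (fun z => φm z i j) (Metric.closedBall 0 1)ᶜ
  jump : ∀ z ∈ Metric.sphere (0 : ℂ) 1, φp z = (γ z).transpose * φm z
  at_infinity : ∀ i j, Filter.Tendsto (fun z => φm z i j) (Filter.cocompact ℂ) (nhds (C i j))

/-- `geometricMean` may be computed with any continuous branch of the logarithm. -/
theorem geometricMean_eq {n : ℕ} {γ : ℂ → Matrix (Fin n) (Fin n) ℂ} {ℓ : ℝ → ℂ}
    (hℓ : IsLogDetBranch γ ℓ) :
    geometricMean γ =
      Complex.exp ((2 * (Real.pi : ℂ))⁻¹ * ∫ θ in (0 : ℝ)..(2 * Real.pi), ℓ θ) := by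
  have h : ∃ ℓ : ℝ → ℂ, IsLogDetBranch γ ℓ := ⟨ℓ, hℓ⟩
  have h0 : (0 : ℝ) ≤ 2 * Real.pi := by positivity
  have hpi : (2 * (Real.pi : ℂ) * Complex.I) ≠ 0 := by simp [Real.pi_ne_zero]
  rw [geometricMean, dif_pos h]
  obtain ⟨hc, he⟩ := h.choose_spec
  set k := h.choose
  obtain ⟨hc', he'⟩ := hℓ
  let d : ℝ → ℂ := fun θ => (k θ - ℓ θ) / (2 * (Real.pi : ℂ) * Complex.I)
  have hd : ContinuousOn d (Set.Icc 0 (2 * Real.pi)) := (hc.sub hc').div_const _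
  have hint : ∀ θ ∈ Set.Icc (0 : ℝ) (2 * Real.pi), ∃ m : ℤ, d θ = m := by
    intro θ hθ
    obtain ⟨m, hm⟩ := Complex.exp_eq_exp_iff_exists_int.1 ((he θ hθ).trans (he' θ hθ).symm)
    refine ⟨m, ?_⟩
    simp only [d, hm]
    field_simp
    ring
  have hconst : ∃ m : ℤ, ∀ θ ∈ Set.Icc (0 : ℝ) (2 * Real.pi), d θ = m := by
    obtain ⟨m, hm⟩ := hint 0 ⟨le_rfl, h0⟩
    refine ⟨m, fun θ hθ => ?_⟩
    have hs : IsPreconnected (d '' Set.Icc (0 : ℝ) (2 * Real.pi)) :=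
      isPreconnected_Icc.image d hd
    have hsub : d '' Set.Icc (0 : ℝ) (2 * Real.pi) ⊆ Set.range ((↑) : ℤ → ℂ) := by
      rintro _ ⟨x, hx, rfl⟩
      obtain ⟨p, hp⟩ := hint x hx
      exact ⟨p, hp.symm⟩
    have hcount : (d '' Set.Icc (0 : ℝ) (2 * Real.pi)).Countable :=
      (Set.countable_range _).mono hsub
    rw [← hm]
    exact hcount.isTotallyDisconnected _ subset_rfl hs
      (Set.mem_image_of_mem d hθ) (Set.mem_image_of_mem d ⟨le_rfl, h0⟩)
  obtain ⟨m, hm⟩ := hconst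
  have hk : (∫ θ in (0 : ℝ)..(2 * Real.pi), k θ) =
      (∫ θ in (0 : ℝ)..(2 * Real.pi), ℓ θ) +
        (2 * (Real.pi : ℂ)) * (m * (2 * (Real.pi : ℂ) * Complex.I)) := by
    have h1 : (∫ θ in (0 : ℝ)..(2 * Real.pi), k θ) =
        ∫ θ in (0 : ℝ)..(2 * Real.pi), (ℓ θ + m * (2 * (Real.pi : ℂ) * Complex.I)) := by
      refine intervalIntegral.integral_congr fun θ hθ => ?_
      rw [Set.uIcc_of_le h0] at hθ
      have h2 := hm θ hθ
      simp only [d] at h2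
      rw [div_eq_iff hpi] at h2
      exact sub_eq_iff_eq_add'.1 h2
    have hi : IntervalIntegrable ℓ MeasureTheory.volume 0 (2 * Real.pi) := by
      refine ContinuousOn.intervalIntegrable ?_
      rwa [Set.uIcc_of_le h0]
    rw [h1, intervalIntegral.integral_add hi intervalIntegrable_const,
      intervalIntegral.integral_const]
    simp
  rw [hk, mul_add, Complex.exp_add, inv_mul_cancel_left₀ (by simp [Real.pi_ne_zero]),
    Complex.exp_int_mul_two_pi_mul_I, mul_one]

end

end BlockToeplitz

namespace BlockToeplitz

open Real
open scoped ComplexOrder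

theorem norm_det_sq_le_exp {ι : Type*} [Fintype ι] [DecidableEq ι] (R : Matrix ι ι ℂ) {K : ℝ}
    (hR : ∑ i, ∑ j, ‖R i j‖ ^ 2 ≤ Fintype.card ι + K) : ‖R.det‖ ^ 2 ≤ Real.exp K := by
  have hpsd : (R * R.conjTranspose).PosSemidef := Matrix.posSemidef_self_mul_conjTranspose R
  have hH := hpsd.isHermitian
  have hdet : ‖R.det‖ ^ 2 = ∏ i, hH.eigenvalues i := by
    have h := hH.det_eq_prod_eigenvalues
    rw [Matrix.det_mul, Matrix.det_conjTranspose, Complex.star_def, Complex.mul_conj,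
      Complex.normSq_eq_norm_sq] at h
    apply Complex.ofReal_injective
    push_cast at h ⊢
    exact h
  have htr : ∑ i, ∑ j, ‖R i j‖ ^ 2 = ∑ i, hH.eigenvalues i := by
    have h := hH.trace_eq_sum_eigenvalues
    simp only [Matrix.trace, Matrix.diag_apply, Matrix.mul_apply, Matrix.conjTranspose_apply,
      Complex.star_def, Complex.mul_conj, Complex.normSq_eq_norm_sq] at h
    apply Complex.ofReal_injective
    push_cast at h ⊢
    exact h
  rw [hdet]
  calc ∏ i, hH.eigenvalues i ≤ ∏ i, Real.exp (hH.eigenvalues i - 1) := by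
        refine Finset.prod_le_prod (fun i _ => hpsd.eigenvalues_nonneg i) fun i _ => ?_
        linarith [Real.add_one_le_exp (hH.eigenvalues i - 1)]
    _ = Real.exp (∑ i, hH.eigenvalues i - Fintype.card ι) := by
        rw [← Real.exp_sum]; simp
    _ ≤ Real.exp K := Real.exp_le_exp.2 (by linarith)

theorem det_add_vecMulVec_vecMul {ι : Type*} [Fintype ι] [DecidableEq ι] (A : Matrix ι ι ℂ)
    (x : ι → ℂ) {i₀ : ι} (hx : x i₀ = 1) (s : ℂ) :
    (A + s • Matrix.vecMulVec (Pi.single i₀ 1) (Matrix.vecMul x A)).det = (1 + s) * A.det := by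
  have h : A + s • Matrix.vecMulVec (Pi.single i₀ 1) (Matrix.vecMul x A) =
      (1 + Matrix.vecMulVec (s • Pi.single i₀ 1) x) * A := by
    rw [add_mul, one_mul, Matrix.vecMulVec_mul, Matrix.smul_vecMulVec]
  rw [h, Matrix.det_mul, Matrix.vecMulVec_eq Unit, Matrix.det_one_add_replicateCol_mul_replicateRow]
  simp [hx]

theorem circleAverage_zpow (k : ℤ) :
    circleAverage (fun z : ℂ => z ^ k) 0 1 = if k = 0 then 1 else 0 := by
  rw [circleAverage_eq_circleIntegral one_ne_zero]
  have h : ∀ z : ℂ, z ∈ Metric.sphere (0:ℂ) 1 → (z - 0)⁻¹ • z ^ k = (z - 0) ^ (k - 1) := by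
    intro z hz
    have : z ≠ 0 := Metric.ne_of_mem_sphere hz one_ne_zero
    rw [sub_zero, smul_eq_mul, zpow_sub_one₀ this, mul_comm]
  rw [circleIntegral.integral_congr zero_le_one h]
  split_ifs with hk
  · subst hk
    have := circleIntegral.integral_sub_center_inv (0:ℂ) (one_ne_zero (α := ℝ))
    simp only [zero_sub, zpow_neg_one]
    rw [this, smul_eq_mul, inv_mul_cancel₀ (by simp [Real.pi_ne_zero])]
  · rw [circleIntegral.integral_sub_zpow_of_ne (by omega), smul_zero]

theorem laurentCoeff_eq_circleAverage {n : ℕ} (γ : ℂ → Matrix (Fin n) (Fin n) ℂ) (k : ℤ)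
    (i j : Fin n) :
    laurentCoeff γ k i j = circleAverage (fun z => z ^ (-k) * γ z i j) 0 1 := by
  rw [circleAverage_eq_circleIntegral one_ne_zero, laurentCoeff, Matrix.of_apply, smul_eq_mul]
  congr 1
  refine circleIntegral.integral_congr zero_le_one fun z hz => ?_
  have : z ≠ 0 := Metric.ne_of_mem_sphere hz one_ne_zero
  simp only [sub_zero, smul_eq_mul]
  rw [zpow_sub_one₀ this]; ring

theorem _root_.ContinuousOn.circleIntegrable_one {E : Type*} [NormedAddCommGroup E] {f : ℂ → E}
    (hf : ContinuousOn f (Metric.sphere 0 1)) : CircleIntegrable f 0 1 :=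
  hf.circleIntegrable zero_le_one

theorem continuousOn_zpow_sphere (k : ℤ) :
    ContinuousOn (fun z : ℂ => z ^ k) (Metric.sphere 0 1) := fun z hz =>
  (continuousAt_zpow₀ z k (Or.inl (Metric.ne_of_mem_sphere hz one_ne_zero))).continuousWithinAt

theorem ofReal_circleAverage (f : ℂ → ℝ) (hf : ContinuousOn f (Metric.sphere 0 1)) :
    ((circleAverage f 0 1 : ℝ) : ℂ) = circleAverage (fun z => (f z : ℂ)) 0 1 := by
  exact (Complex.ofRealCLM.circleAverage_comp_comm hf.circleIntegrable_one).symm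

theorem circleAverage_const_mul (c : ℂ) (f : ℂ → ℂ) :
    circleAverage (fun z => c * f z) 0 1 = c * circleAverage f 0 1 :=
  circleAverage_fun_smul (a := c) (f := f)

theorem conj_eq_inv_of_mem_sphere {z : ℂ} (hz : z ∈ Metric.sphere (0 : ℂ) 1) :
    (starRingEnd ℂ) z = z⁻¹ := by
  rw [Complex.inv_def, Complex.normSq_eq_norm_sq, mem_sphere_zero_iff_norm.1 hz]; simp

/-- The average of `g` against the conjugate of a polynomial in `z⁻¹`. -/
theorem circleAverage_mul_conj_sum (g : ℂ → ℂ) (hg : ContinuousOn g (Metric.sphere 0 1))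
    (c : ℕ → ℂ) (N : ℕ) :
    circleAverage (fun z => g z * (starRingEnd ℂ) (∑ q ∈ Finset.range N, c q * z ^ (-(q : ℤ)))) 0 1 =
      ∑ q ∈ Finset.range N, (starRingEnd ℂ) (c q) *
        circleAverage (fun z => z ^ (q : ℤ) * g z) 0 1 := by
  rw [circleAverage_congr_sphere (f₂ := fun z => ∑ q ∈ Finset.range N,
    (starRingEnd ℂ) (c q) * (z ^ (q : ℤ) * g z)), circleAverage_fun_sum]
  · exact Finset.sum_congr rfl fun q _ => circleAverage_const_mul _ _
  · intro q _
    exact (continuousOn_const.mul ((continuousOn_zpow_sphere q).mul hg)).circleIntegrable_one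
  · intro z hz
    rw [abs_one] at hz
    simp only [map_sum, map_mul, Finset.mul_sum]
    refine Finset.sum_congr rfl fun q _ => ?_
    rw [map_zpow₀, conj_eq_inv_of_mem_sphere hz, inv_zpow', neg_neg]
    ring

theorem continuousOn_sum_zpow (c : ℕ → ℂ) (N : ℕ) :
    ContinuousOn (fun z : ℂ => ∑ q ∈ Finset.range N, c q * z ^ (-(q : ℤ))) (Metric.sphere 0 1) :=
  continuousOn_finsetSum _ fun _ _ => continuousOn_const.mul (continuousOn_zpow_sphere _)

theorem circleAverage_norm_sum_sq (c : ℕ → ℂ) (N : ℕ) :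
    circleAverage (fun z : ℂ => ‖∑ q ∈ Finset.range N, c q * z ^ (-(q : ℤ))‖ ^ 2) 0 1 =
      ∑ q ∈ Finset.range N, ‖c q‖ ^ 2 := by
  have hc := continuousOn_sum_zpow c N
  rw [← Complex.ofReal_inj, ofReal_circleAverage (fun z => ‖_‖ ^ 2) (hc.norm.pow 2)]
  have h := circleAverage_mul_conj_sum _ hc c N
  simp only [Complex.mul_conj, Complex.normSq_eq_norm_sq] at h
  rw [h, Complex.ofReal_sum]
  refine Finset.sum_congr rfl fun q hq => ?_
  rw [circleAverage_congr_sphere (f₂ := fun z => ∑ p ∈ Finset.range N,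
    c p * z ^ ((q : ℤ) - p)), circleAverage_fun_sum]
  · simp only [circleAverage_const_mul, circleAverage_zpow, sub_eq_zero, Nat.cast_inj, mul_ite,
      mul_one, mul_zero, Finset.sum_ite_eq, hq, if_true]
    rw [mul_comm, Complex.mul_conj, Complex.normSq_eq_norm_sq]
  · intro p _
    exact (continuousOn_const.mul (continuousOn_zpow_sphere _)).circleIntegrable_one
  · intro z hz
    rw [abs_one] at hz
    have : z ≠ 0 := Metric.ne_of_mem_sphere hz one_ne_zero
    simp only [Finset.mul_sum]
    refine Finset.sum_congr rfl fun p _ => ?_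
    rw [sub_eq_add_neg, zpow_add₀ this]; ring

/-- Bessel's inequality on the unit circle. -/
theorem sum_norm_circleAverage_sq_le (g : ℂ → ℂ) (hg : ContinuousOn g (Metric.sphere 0 1))
    (N : ℕ) :
    ∑ q ∈ Finset.range N, ‖circleAverage (fun z => z ^ (q : ℤ) * g z) 0 1‖ ^ 2 ≤
      circleAverage (fun z => ‖g z‖ ^ 2) 0 1 := by
  set c : ℕ → ℂ := fun q => circleAverage (fun z => z ^ (q : ℤ) * g z) 0 1 with hcdef
  set p : ℂ → ℂ := fun z => ∑ q ∈ Finset.range N, c q * z ^ (-(q : ℤ)) with hp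
  have hpc : ContinuousOn p (Metric.sphere 0 1) := continuousOn_sum_zpow c N
  have h0 : 0 ≤ circleAverage (fun z => ‖g z - p z‖ ^ 2) 0 1 :=
    circleAverage_nonneg_of_nonneg fun z _ => by positivity
  have hcross : circleAverage (fun z => (g z * (starRingEnd ℂ) (p z)).re) 0 1 =
      ∑ q ∈ Finset.range N, ‖c q‖ ^ 2 := by
    have hcont : ContinuousOn (fun z => g z * (starRingEnd ℂ) (p z)) (Metric.sphere 0 1) :=
      hg.mul (Complex.continuous_conj.comp_continuousOn hpc)
    have h1 := Complex.reCLM.circleAverage_comp_comm hcont.circleIntegrable_one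
    have h2 := circleAverage_mul_conj_sum g hg c N
    have h3 : circleAverage (fun z => (g z * (starRingEnd ℂ) (p z)).re) 0 1 =
      (circleAverage (fun z => (g z * (starRingEnd ℂ) (p z))) 0 1).re := h1
    rw [h3, h2, Complex.re_sum]
    refine Finset.sum_congr rfl fun q _ => ?_
    change ((starRingEnd ℂ) (c q) * c q).re = _
    rw [mul_comm, Complex.mul_conj, Complex.normSq_eq_norm_sq, Complex.ofReal_re]
  have hcontr : ContinuousOn (fun z => (g z * (starRingEnd ℂ) (p z)).re) (Metric.sphere 0 1) :=
    Complex.continuous_re.comp_continuousOn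
      (hg.mul (Complex.continuous_conj.comp_continuousOn hpc))
  have hexp : circleAverage (fun z => ‖g z - p z‖ ^ 2) 0 1 =
      circleAverage (fun z => ‖g z‖ ^ 2) 0 1 + circleAverage (fun z => ‖p z‖ ^ 2) 0 1 -
        2 * circleAverage (fun z => (g z * (starRingEnd ℂ) (p z)).re) 0 1 := by
    have hs : circleAverage (fun z => (2:ℝ) * (g z * (starRingEnd ℂ) (p z)).re) 0 1 =
      2 * circleAverage (fun z => (g z * (starRingEnd ℂ) (p z)).re) 0 1 :=
      circleAverage_fun_smul (a := (2:ℝ))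
    rw [← hs, ← circleAverage_fun_add (f₁ := fun z => ‖g z‖ ^ 2) (f₂ := fun z => ‖p z‖ ^ 2)
      (hg.norm.pow 2).circleIntegrable_one
      (hpc.norm.pow 2).circleIntegrable_one, ← circleAverage_fun_sub
      (f₁ := fun z => ‖g z‖ ^ 2 + ‖p z‖ ^ 2) (f₂ := fun z => 2 * (g z * (starRingEnd ℂ) (p z)).re)
      ((hg.norm.pow 2).add (hpc.norm.pow 2)).circleIntegrable_one
      (continuousOn_const.mul hcontr).circleIntegrable_one]
    congr 1
    funext z
    simp only [← Complex.normSq_eq_norm_sq]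
    rw [Complex.normSq_sub]
  have hpp := circleAverage_norm_sum_sq c N
  change circleAverage (fun z => ‖p z‖ ^ 2) 0 1 = _ at hpp
  linarith

/-- The geometric kernel with pole `ζ` decays away from `ζ`. -/
theorem norm_sub_sq_mul_norm_sum_sq_le {ζ z : ℂ} (hζ : ‖ζ‖ = 1) (hz : ‖z‖ = 1) (N : ℕ) :
    ‖z - ζ‖ ^ 2 * ‖∑ q ∈ Finset.range N, ζ ^ q * z ^ (-(q : ℤ))‖ ^ 2 ≤ 4 := by
  have hz0 : z ≠ 0 := norm_ne_zero_iff.1 (by rw [hz]; exact one_ne_zero)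
  have h1 : ∀ q : ℕ, ζ ^ q * z ^ (-(q : ℤ)) = (ζ * z⁻¹) ^ q := fun q => by
    rw [zpow_neg, zpow_natCast, mul_pow, inv_pow]
  have h2 : (z - ζ) * ∑ q ∈ Finset.range N, ζ ^ q * z ^ (-(q : ℤ)) =
      z * (1 - (ζ * z⁻¹) ^ N) := by
    simp only [h1]
    rw [← mul_neg_geom_sum, ← mul_assoc]
    congr 1
    field_simp
  rw [← mul_pow, ← norm_mul, h2, norm_mul, hz, one_mul]
  have h3 : ‖1 - (ζ * z⁻¹) ^ N‖ ≤ 2 := by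
    refine (norm_sub_le _ _).trans ?_
    simp [hζ, hz]; norm_num
  nlinarith [norm_nonneg (1 - (ζ * z⁻¹) ^ N)]

end BlockToeplitz

namespace BlockToeplitz

open Real
open scoped Kronecker

/-- The `j`-th of the `N + 1` equidistant nodes on the unit circle. -/
noncomputable def circleNode (N : ℕ) (j : ℕ) : ℂ :=
  Complex.exp (((2 * π * j / (N + 1) : ℝ) : ℂ) * Complex.I)

theorem norm_circleNode (N j : ℕ) : ‖circleNode N j‖ = 1 := Complex.norm_exp_ofReal_mul_I _

theorem circleNode_mem_sphere (N j : ℕ) : circleNode N j ∈ Metric.sphere (0 : ℂ) 1 := by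
  simp [norm_circleNode]

theorem circleNode_eq_pow (N j : ℕ) :
    circleNode N j = Complex.exp (2 * π * Complex.I / ((N + 1 : ℕ) : ℂ)) ^ j := by
  rw [circleNode, ← Complex.exp_nat_mul]
  congr 1
  push_cast
  ring

/-- Orthogonality of the discrete Fourier basis. -/
theorem sum_circleNode_pow_mul_conj (N : ℕ) (j k : Fin (N + 1)) :
    ∑ p : Fin (N + 1), circleNode N j ^ (p : ℕ) * (starRingEnd ℂ) (circleNode N k ^ (p : ℕ)) =
      if j = k then (N + 1 : ℂ) else 0 := by
  have hω := Complex.isPrimitiveRoot_exp (N + 1) N.succ_ne_zero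
  set w : ℂ := circleNode N j * (circleNode N k)⁻¹ with hw
  have hk0 : circleNode N k ≠ 0 := Complex.exp_ne_zero _
  have hterm : ∀ p : ℕ, circleNode N j ^ p * (starRingEnd ℂ) (circleNode N k ^ p) = w ^ p := by
    intro p
    rw [map_pow, conj_eq_inv_of_mem_sphere (circleNode_mem_sphere N k), hw, mul_pow]
  simp only [hterm]
  rw [Fin.sum_univ_eq_sum_range (fun p => w ^ p)]
  split_ifs with h
  · subst h
    simp [hw, mul_inv_cancel₀ hk0]
  · have hw1 : w ≠ 1 := by
      intro h1
      rw [hw, ← div_eq_mul_inv, div_eq_one_iff_eq hk0, circleNode_eq_pow, circleNode_eq_pow] at h1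
      exact h (Fin.ext (hω.pow_inj j.2 k.2 h1))
    have hpow : ∀ i : ℕ, circleNode N i ^ (N + 1) = 1 := fun i => by
      rw [circleNode_eq_pow, ← pow_mul, mul_comm i, pow_mul, hω.pow_eq_one, one_pow]
    have hwN : w ^ (N + 1) = 1 := by rw [hw, mul_pow, inv_pow, hpow, hpow]; simp
    rw [geom_sum_eq hw1, hwN, sub_self, zero_div]

/-- The unitary matrix of the discrete Fourier transform. -/
noncomputable def dftMatrix (N : ℕ) : Matrix (Fin (N + 1)) (Fin (N + 1)) ℂ :=
  Matrix.of fun j p => ((√(N + 1 : ℝ) : ℝ) : ℂ)⁻¹ * circleNode N j ^ (p : ℕ)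

theorem norm_det_dftMatrix (N : ℕ) : ‖(dftMatrix N).det‖ = 1 := by
  have hs : ((√(N + 1 : ℝ) : ℝ) : ℂ) * ((√(N + 1 : ℝ) : ℝ) : ℂ) = N + 1 := by
    rw [← Complex.ofReal_mul, Real.mul_self_sqrt (by positivity)]; push_cast; ring
  have hN : (N + 1 : ℂ) ≠ 0 := by exact_mod_cast N.succ_ne_zero
  have h : dftMatrix N * (dftMatrix N).conjTranspose = 1 := by
    ext j k
    have hs' : ((√(N + 1 : ℝ) : ℝ) : ℂ)⁻¹ * ((√(N + 1 : ℝ) : ℝ) : ℂ)⁻¹ = (N + 1 : ℂ)⁻¹ := by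
      rw [← mul_inv, hs]
    have : ∀ p : Fin (N + 1), dftMatrix N j p * (dftMatrix N).conjTranspose p k =
        (N + 1 : ℂ)⁻¹ * (circleNode N j ^ (p : ℕ) *
          (starRingEnd ℂ) (circleNode N k ^ (p : ℕ))) := by
      intro p
      simp only [dftMatrix, Matrix.conjTranspose_apply, Matrix.of_apply, Complex.star_def, map_mul,
        map_inv₀, Complex.conj_ofReal]
      rw [← hs']; ring
    rw [Matrix.mul_apply, Finset.sum_congr rfl fun p _ => this p, ← Finset.mul_sum,
      sum_circleNode_pow_mul_conj, Matrix.one_apply]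
    split_ifs <;> simp [hN]
  have hd := congrArg Matrix.det h
  rw [Matrix.det_mul, Matrix.det_conjTranspose, Matrix.det_one, Complex.star_def,
    Complex.mul_conj, Complex.normSq_eq_norm_sq] at hd
  have h2 : ‖(dftMatrix N).det‖ ^ 2 = 1 := by exact_mod_cast hd
  exact (pow_eq_one_iff_of_nonneg (norm_nonneg _) two_ne_zero).1 h2

/-- The discrete Fourier transform followed by multiplication with `γ⁻¹` at each node. -/
noncomputable def preconditioner {n : ℕ} (γ : ℂ → Matrix (Fin n) (Fin n) ℂ) (N : ℕ) :
    Matrix (Fin (N + 1) × Fin n) (Fin (N + 1) × Fin n) ℂ :=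
  Matrix.of fun p q => dftMatrix N p.1 q.1 * (γ (circleNode N p.1))⁻¹ p.2 q.2

theorem norm_det_preconditioner {n : ℕ} (γ : ℂ → Matrix (Fin n) (Fin n) ℂ) (N : ℕ) :
    ‖(preconditioner γ N).det‖ = ∏ j : Fin (N + 1), ‖(γ (circleNode N j)).det‖⁻¹ := by
  have h : preconditioner γ N =
      (Matrix.blockDiagonal fun j : Fin (N + 1) => (γ (circleNode N j))⁻¹).submatrix
        (Equiv.prodComm _ _) (Equiv.prodComm _ _) *
        (dftMatrix N ⊗ₖ (1 : Matrix (Fin n) (Fin n) ℂ)) := by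
    ext ⟨j, i⟩ ⟨p, l⟩
    simp only [preconditioner, Matrix.of_apply, Matrix.mul_apply, Matrix.submatrix_apply,
      Fintype.sum_prod_type, Equiv.prodComm_apply, Prod.swap_prod_mk,
      Matrix.blockDiagonal_apply, Matrix.kroneckerMap_apply, Matrix.one_apply]
    simp [mul_comm]
  rw [h, Matrix.det_mul, Matrix.det_submatrix_equiv_self, Matrix.det_blockDiagonal,
    Matrix.det_kronecker, norm_mul, norm_mul, norm_pow, norm_det_dftMatrix]
  simp [norm_prod, Matrix.det_nonsing_inv]

section Continuity

variable {n : ℕ} {γ : ℂ → Matrix (Fin n) (Fin n) ℂ} {s : Set ℂ}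

theorem continuousOn_inv (hγ : ContinuousOn γ s) (hinv : ∀ z ∈ s, IsUnit (γ z)) :
    ContinuousOn (fun z => (γ z)⁻¹) s := by
  have hdet : ContinuousOn (fun z => (γ z).det) s :=
    (continuous_id.matrix_det).comp_continuousOn hγ
  have hadj : ContinuousOn (fun z => (γ z).adjugate) s :=
    (continuous_id.matrix_adjugate).comp_continuousOn hγ
  simp only [Matrix.inv_def, Ring.inverse_eq_inv']
  exact (hdet.inv₀ fun z hz => ((Matrix.isUnit_iff_isUnit_det _).1 (hinv z hz)).ne_zero).smul hadj

theorem exists_sum_norm_inv_mul_sq_le (hs : IsCompact s) (hγ : ContinuousOn γ s)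
    (hinv : ∀ z ∈ s, IsUnit (γ z)) {η : ℝ} (hη : 0 < η) :
    ∃ K : ℝ, 0 ≤ K ∧ ∀ ζ ∈ s, ∀ z ∈ s,
      ∑ i, ∑ l, ‖((γ ζ)⁻¹ * γ z) i l‖ ^ 2 ≤ n + η + K * ‖z - ζ‖ ^ 2 := by
  set h : ℂ × ℂ → ℝ := fun w => ∑ i, ∑ l, ‖((γ w.1)⁻¹ * γ w.2) i l‖ ^ 2 with hh
  have hcont : ContinuousOn h (s ×ˢ s) := by
    have h1 : ContinuousOn (fun w : ℂ × ℂ => (γ w.1)⁻¹ * γ w.2) (s ×ˢ s) :=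
      ((continuousOn_inv hγ hinv).comp continuousOn_fst fun w hw => hw.1).mul
        (hγ.comp continuousOn_snd fun w hw => hw.2)
    refine continuousOn_finsetSum _ fun i _ => continuousOn_finsetSum _ fun l _ => ?_
    exact ((((continuous_apply_apply i l).comp_continuousOn h1)).norm).pow 2
  have hdiag : ∀ ζ ∈ s, h (ζ, ζ) = n := by
    intro ζ hζ
    have : (γ ζ)⁻¹ * γ ζ = 1 :=
      Matrix.nonsing_inv_mul _ ((Matrix.isUnit_iff_isUnit_det _).1 (hinv ζ hζ))
    simp only [hh, this, Matrix.one_apply]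
    simp [apply_ite norm]
  obtain ⟨B, hB⟩ := (hs.prod hs).exists_bound_of_continuousOn hcont
  obtain ⟨δ, hδ, hu⟩ := Metric.uniformContinuousOn_iff.1
    ((hs.prod hs).uniformContinuousOn_of_continuous hcont) η hη
  refine ⟨|B| / δ ^ 2, by positivity, fun ζ hζ z hz => ?_⟩
  change h (ζ, z) ≤ _
  by_cases hzζ : ‖z - ζ‖ < δ
  · have h1 := hu (ζ, z) ⟨hζ, hz⟩ (ζ, ζ) ⟨hζ, hζ⟩ (by
      rw [Prod.dist_eq]; simpa [dist_eq_norm, hδ] using hzζ)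
    rw [hdiag ζ hζ, Real.dist_eq] at h1
    have h2 : 0 ≤ |B| / δ ^ 2 * ‖z - ζ‖ ^ 2 := by positivity
    linarith [(abs_lt.1 h1).2]
  · have h1 : h (ζ, z) ≤ |B| := (le_abs_self _).trans ((hB _ ⟨hζ, hz⟩).trans (le_abs_self B))
    have h2 : |B| ≤ |B| / δ ^ 2 * ‖z - ζ‖ ^ 2 := by
      rw [div_mul_eq_mul_div, le_div_iff₀ (by positivity)]
      exact mul_le_mul_of_nonneg_left (pow_le_pow_left₀ hδ.le (not_lt.1 hzζ) 2) (abs_nonneg B)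
    have h3 : (0 : ℝ) ≤ n := by positivity
    linarith

end Continuity

section Frobenius

variable {n : ℕ} {γ : ℂ → Matrix (Fin n) (Fin n) ℂ}

theorem preconditioner_mul_toeplitzMatrix_apply (hγ : ContinuousOn γ (Metric.sphere 0 1)) (N : ℕ)
    (j : Fin (N + 1)) (i : Fin n) (q : Fin (N + 1)) (l : Fin n) :
    (preconditioner γ N * toeplitzMatrix γ N) (j, i) (q, l) =
      circleAverage (fun z => z ^ ((q : ℕ) : ℤ) * (((√(N + 1 : ℝ) : ℝ) : ℂ)⁻¹ *
        (∑ p ∈ Finset.range (N + 1), circleNode N j ^ p * z ^ (-(p : ℤ))) *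
        ((γ (circleNode N j))⁻¹ * γ z) i l)) 0 1 := by
  have hent : ∀ i' l, ContinuousOn (fun z => γ z i' l) (Metric.sphere 0 1) := fun i' l =>
    (continuous_apply_apply i' l).comp_continuousOn hγ
  rw [circleAverage_congr_sphere (f₂ := fun z => ∑ p : Fin (N + 1), ∑ i' : Fin n,
    (dftMatrix N j p * (γ (circleNode N j))⁻¹ i i') *
      (z ^ (-(((p : ℕ) : ℤ) - ((q : ℕ) : ℤ))) * γ z i' l)), circleAverage_fun_sum]
  · rw [Matrix.mul_apply, Fintype.sum_prod_type]
    refine Finset.sum_congr rfl fun p _ => ?_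
    rw [circleAverage_fun_sum]
    · refine Finset.sum_congr rfl fun i' _ => ?_
      rw [circleAverage_const_mul, ← laurentCoeff_eq_circleAverage]
      rfl
    · intro i' _
      exact (continuousOn_const.mul ((continuousOn_zpow_sphere _).mul
        (hent _ _))).circleIntegrable_one
  · intro p _
    exact (continuousOn_finsetSum _ fun i' _ => continuousOn_const.mul
      ((continuousOn_zpow_sphere _).mul (hent _ _))).circleIntegrable_one
  · intro z hz
    rw [abs_one] at hz
    have hz0 : z ≠ 0 := Metric.ne_of_mem_sphere hz one_ne_zero
    simp only [Matrix.mul_apply, dftMatrix, Matrix.of_apply]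
    rw [← Fin.sum_univ_eq_sum_range (fun p => circleNode N j ^ p * z ^ (-(p : ℤ)))]
    simp only [Finset.mul_sum, Finset.sum_mul]
    rw [Finset.sum_comm]
    refine Finset.sum_congr rfl fun p _ => ?_
    refine Finset.sum_congr rfl fun i' _ => ?_
    rw [neg_sub, sub_eq_add_neg, zpow_add₀ hz0]
    ring

theorem sum_norm_preconditioner_mul_toeplitzMatrix_sq_le
    (hγ : ContinuousOn γ (Metric.sphere 0 1)) {a K : ℝ} (hK : 0 ≤ K)
    (hh : ∀ ζ ∈ Metric.sphere (0 : ℂ) 1, ∀ z ∈ Metric.sphere (0 : ℂ) 1,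
      ∑ i, ∑ l, ‖((γ ζ)⁻¹ * γ z) i l‖ ^ 2 ≤ a + K * ‖z - ζ‖ ^ 2) (N : ℕ) :
    ∑ p, ∑ q, ‖(preconditioner γ N * toeplitzMatrix γ N) p q‖ ^ 2 ≤ (N + 1) * a + 4 * K := by
  have hN : (0 : ℝ) < N + 1 := by positivity
  set k : Fin (N + 1) → ℂ → ℂ := fun j z =>
    ∑ p ∈ Finset.range (N + 1), circleNode N j ^ p * z ^ (-(p : ℤ)) with hk
  have hkc : ∀ j, ContinuousOn (k j) (Metric.sphere 0 1) := fun j =>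
    continuousOn_sum_zpow (fun p => circleNode N j ^ p) (N + 1)
  set g : Fin (N + 1) → Fin n → Fin n → ℂ → ℂ := fun j i l z =>
    ((√(N + 1 : ℝ) : ℝ) : ℂ)⁻¹ * k j z * ((γ (circleNode N j))⁻¹ * γ z) i l with hg
  have hgc : ∀ j i l, ContinuousOn (g j i l) (Metric.sphere 0 1) := fun j i l =>
    (continuousOn_const.mul (hkc j)).mul
      ((continuous_apply_apply i l).comp_continuousOn (continuousOn_const.mul hγ))
  have hnode : ∀ j : Fin (N + 1), ∑ i, ∑ q, ‖(preconditioner γ N * toeplitzMatrix γ N) (j, i) q‖ ^ 2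
      ≤ a + 4 * K / (N + 1) := by
    intro j
    have h1 : ∀ i, ∑ q, ‖(preconditioner γ N * toeplitzMatrix γ N) (j, i) q‖ ^ 2 ≤
        ∑ l, circleAverage (fun z => ‖g j i l z‖ ^ 2) 0 1 := by
      intro i
      rw [Fintype.sum_prod_type, Finset.sum_comm]
      refine Finset.sum_le_sum fun l _ => ?_
      refine le_trans (le_of_eq ?_) (sum_norm_circleAverage_sq_le (g j i l) (hgc j i l) (N + 1))
      rw [← Fin.sum_univ_eq_sum_range
        (fun q => ‖circleAverage (fun z => z ^ (q : ℤ) * g j i l z) 0 1‖ ^ 2)]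
      refine Finset.sum_congr rfl fun q _ => ?_
      rw [preconditioner_mul_toeplitzMatrix_apply hγ]
    refine (Finset.sum_le_sum fun i _ => h1 i).trans ?_
    have hci : ∀ i l, CircleIntegrable (fun z => ‖g j i l z‖ ^ 2) 0 1 := fun i l =>
      ((hgc j i l).norm.pow 2).circleIntegrable_one
    have h2 : ∑ i, ∑ l, circleAverage (fun z => ‖g j i l z‖ ^ 2) 0 1 =
        circleAverage (fun z => ∑ i, ∑ l, ‖g j i l z‖ ^ 2) 0 1 := by
      rw [circleAverage_fun_sum fun i _ => ?_]
      · exact Finset.sum_congr rfl fun i _ => (circleAverage_fun_sum fun l _ => hci i l).symm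
      · exact (continuousOn_finsetSum _ fun l _ =>
          (hgc j i l).norm.pow 2).circleIntegrable_one
    rw [h2]
    have hka : circleAverage (fun z => ‖k j z‖ ^ 2) 0 1 = N + 1 := by
      rw [hk, circleAverage_norm_sum_sq]
      simp [norm_circleNode]
    have h3 : circleAverage (fun z => ∑ i, ∑ l, ‖g j i l z‖ ^ 2) 0 1 ≤
        circleAverage (fun z => a / (N + 1) * ‖k j z‖ ^ 2 + 4 * K / (N + 1)) 0 1 := by
      refine circleAverage_mono ?_ ?_ fun z hz => ?_
      · exact (continuousOn_finsetSum _ fun i _ => continuousOn_finsetSum _ fun l _ =>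
          (hgc j i l).norm.pow 2).circleIntegrable_one
      · exact ((continuousOn_const.mul ((hkc j).norm.pow 2)).add
          continuousOn_const).circleIntegrable_one
      · rw [abs_one] at hz
        have e : ∑ i, ∑ l, ‖g j i l z‖ ^ 2 = ‖k j z‖ ^ 2 / (N + 1) *
            ∑ i, ∑ l, ‖((γ (circleNode N j))⁻¹ * γ z) i l‖ ^ 2 := by
          simp only [Finset.mul_sum, hg, norm_mul, mul_pow, norm_inv, Complex.norm_real,
            Real.norm_eq_abs, abs_of_nonneg (Real.sqrt_nonneg _), inv_pow, Real.sq_sqrt hN.le]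
          refine Finset.sum_congr rfl fun i _ => Finset.sum_congr rfl fun l _ => ?_
          ring
        have b := norm_sub_sq_mul_norm_sum_sq_le (norm_circleNode N j)
          (mem_sphere_zero_iff_norm.1 hz) (N + 1)
        change ‖z - circleNode N j‖ ^ 2 * ‖k j z‖ ^ 2 ≤ 4 at b
        rw [e]
        calc _ ≤ ‖k j z‖ ^ 2 / (N + 1) * (a + K * ‖z - circleNode N j‖ ^ 2) :=
              mul_le_mul_of_nonneg_left (hh _ (circleNode_mem_sphere N j) z hz) (by positivity)
          _ = a / (N + 1) * ‖k j z‖ ^ 2 +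
              K * (‖z - circleNode N j‖ ^ 2 * ‖k j z‖ ^ 2) / (N + 1) := by ring
          _ ≤ a / (N + 1) * ‖k j z‖ ^ 2 + K * 4 / (N + 1) := by gcongr
          _ = _ := by ring
    refine h3.trans (le_of_eq ?_)
    rw [circleAverage_fun_add (f₁ := fun z => a / (N + 1) * ‖k j z‖ ^ 2)
      (f₂ := fun z => 4 * K / (N + 1))
      (continuousOn_const.mul ((hkc j).norm.pow 2)).circleIntegrable_one
      continuousOn_const.circleIntegrable_one, circleAverage_const]
    have : circleAverage (fun z => a / (N + 1) * ‖k j z‖ ^ 2) 0 1 = a / (N + 1) *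
      circleAverage (fun z => ‖k j z‖ ^ 2) 0 1 := circleAverage_fun_smul (a := a / ((N:ℝ) + 1))
    rw [this, hka]
    field_simp
  rw [Fintype.sum_prod_type]
  refine (Finset.sum_le_sum fun j _ => hnode j).trans (le_of_eq ?_)
  rw [Finset.sum_const, Finset.card_univ, Fintype.card_fin, nsmul_eq_mul]
  push_cast
  field_simp

theorem sum_norm_preconditioner_col_sq_le {b : ℝ}
    (hb : ∀ z ∈ Metric.sphere (0 : ℂ) 1, ∀ l, ∑ i, ‖(γ z)⁻¹ i l‖ ^ 2 ≤ b) (N : ℕ)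
    (q : Fin (N + 1) × Fin n) : ∑ p, ‖preconditioner γ N p q‖ ^ 2 ≤ b := by
  have hN : (0 : ℝ) < N + 1 := by positivity
  have h : ∀ j : Fin (N + 1), ∑ i, ‖preconditioner γ N (j, i) q‖ ^ 2 ≤ b / (N + 1) := by
    intro j
    have e : ∑ i, ‖preconditioner γ N (j, i) q‖ ^ 2 =
        (∑ i, ‖(γ (circleNode N j))⁻¹ i q.2‖ ^ 2) / (N + 1) := by
      rw [Finset.sum_div]
      refine Finset.sum_congr rfl fun i _ => ?_
      simp only [preconditioner, dftMatrix, Matrix.of_apply, norm_mul, mul_pow, norm_inv,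
        Complex.norm_real, Real.norm_eq_abs, abs_of_nonneg (Real.sqrt_nonneg _), inv_pow,
        Real.sq_sqrt hN.le, norm_pow, norm_circleNode, one_pow]
      ring
    rw [e]
    gcongr
    exact hb _ (circleNode_mem_sphere N j) _
  rw [Fintype.sum_prod_type]
  refine (Finset.sum_le_sum fun j _ => h j).trans (le_of_eq ?_)
  rw [Finset.sum_const, Finset.card_univ, Fintype.card_fin, nsmul_eq_mul]
  push_cast
  field_simp

end Frobenius

end BlockToeplitz

namespace BlockToeplitz

open Real Filter Topology

theorem eventually_sum_le_mul_average_add {f : ℝ → ℝ} (hf : ContinuousOn f (Set.Icc 0 (2 * π)))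
    {η : ℝ} (hη : 0 < η) :
    ∀ᶠ N : ℕ in atTop, ∑ j : Fin (N + 1), f (2 * π * (j : ℕ) / (N + 1)) ≤
      (N + 1) * ((2 * π)⁻¹ * (∫ θ in (0 : ℝ)..(2 * π), f θ) + η) := by
  obtain ⟨δ, hδ, hu⟩ := Metric.uniformContinuousOn_iff.1
    (isCompact_Icc.uniformContinuousOn_of_continuous hf) η hη
  have hlim : Tendsto (fun N : ℕ => 2 * π * (1 / ((N : ℝ) + 1))) atTop (𝓝 0) := by
    simpa using tendsto_one_div_add_atTop_nhds_zero_nat.const_mul (2 * π)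
  filter_upwards [hlim.eventually (gt_mem_nhds hδ)] with N hN
  have hN0 : (0 : ℝ) < N + 1 := by positivity
  set t : ℕ → ℝ := fun j => 2 * π * j / (N + 1) with ht
  have hmono : ∀ j, t j ≤ t (j + 1) := fun j => by simp only [ht]; push_cast; gcongr; linarith
  have hstep : ∀ j, t (j + 1) - t j = 2 * π * (1 / ((N : ℝ) + 1)) := fun j => by
    simp only [ht]; push_cast; ring
  have ht0 : t 0 = 0 := by simp [ht]
  have htN : t (N + 1) = 2 * π := by simp only [ht]; push_cast; field_simp
  have htm : Monotone t := monotone_nat_of_le_succ hmono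
  have hmem : ∀ j ≤ N + 1, t j ∈ Set.Icc 0 (2 * π) := fun j hj =>
    ⟨ht0 ▸ htm (Nat.zero_le j), htN ▸ htm hj⟩
  have hsub : ∀ j < N + 1, Set.Icc (t j) (t (j + 1)) ⊆ Set.Icc 0 (2 * π) := fun j hj =>
    Set.Icc_subset_Icc (hmem j hj.le).1 (hmem (j + 1) hj).2
  have hint : ∀ j < N + 1, IntervalIntegrable f MeasureTheory.volume (t j) (t (j + 1)) :=
    fun j hj => ContinuousOn.intervalIntegrable (by
      rw [Set.uIcc_of_le (hmono j)]; exact hf.mono (hsub j hj))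
  have hpiece : ∀ j < N + 1, 2 * π * (1 / ((N : ℝ) + 1)) * (f (t j) - η) ≤
      ∫ θ in t j..t (j + 1), f θ := by
    intro j hj
    have h1 : ∫ _ in t j..t (j + 1), (f (t j) - η) ≤ ∫ θ in t j..t (j + 1), f θ := by
      refine intervalIntegral.integral_mono_on (hmono j) intervalIntegrable_const (hint j hj)
        fun θ hθ => ?_
      have h2 := hu (t j) (hmem j hj.le) θ (hsub j hj hθ) (by
        rw [Real.dist_eq, abs_sub_comm, abs_of_nonneg (by linarith [hθ.1])]
        linarith [hθ.2, hstep j])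
      rw [Real.dist_eq] at h2
      linarith [(abs_lt.1 h2).2]
    rwa [intervalIntegral.integral_const, hstep j, smul_eq_mul] at h1
  have hsum := intervalIntegral.sum_integral_adjacent_intervals (n := N + 1) (a := t) hint
  rw [ht0, htN] at hsum
  rw [← hsum, Fin.sum_univ_eq_sum_range (fun j => f (t j))]
  have h3 : ∑ j ∈ Finset.range (N + 1), 2 * π * (1 / ((N : ℝ) + 1)) * (f (t j) - η) ≤
      ∑ j ∈ Finset.range (N + 1), ∫ θ in t j..t (j + 1), f θ :=
    Finset.sum_le_sum fun j hj => hpiece j (Finset.mem_range.1 hj)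
  rw [← Finset.mul_sum, Finset.sum_sub_distrib, Finset.sum_const, Finset.card_range,
    nsmul_eq_mul] at h3
  push_cast at h3
  set I := ∑ j ∈ Finset.range (N + 1), ∫ θ in t j..t (j + 1), f θ
  set T := ∑ j ∈ Finset.range (N + 1), f (t j)
  have hpi : 0 < 2 * π := by positivity
  have h4 : 2 * π * (T - (N + 1) * η) ≤ (N + 1) * I := by
    have := mul_le_mul_of_nonneg_left h3 hN0.le
    calc _ = (N + 1 : ℝ) * (2 * π * (1 / ((N : ℝ) + 1)) * (T - (N + 1) * η)) := by field_simp
      _ ≤ _ := this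
  have h5 : T - (N + 1) * η ≤ (N + 1) * ((2 * π)⁻¹ * I) := by
    rw [← mul_le_mul_iff_right₀ hpi]
    refine h4.trans (le_of_eq ?_)
    field_simp
  linarith

theorem norm_add_sq_le_weighted {E : Type*} [SeminormedAddCommGroup E] (u v : E) {η : ℝ}
    (hη : 0 < η) : ‖u + v‖ ^ 2 ≤ (1 + η) * ‖u‖ ^ 2 + (1 + η⁻¹) * ‖v‖ ^ 2 := by
  have h1 : ‖u + v‖ ^ 2 ≤ (‖u‖ + ‖v‖) ^ 2 := pow_le_pow_left₀ (norm_nonneg _) (norm_add_le u v) 2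
  have h2 : 2 * ‖u‖ * ‖v‖ ≤ η * ‖u‖ ^ 2 + η⁻¹ * ‖v‖ ^ 2 := by
    have h := mul_nonneg hη.le (sq_nonneg (‖u‖ - η⁻¹ * ‖v‖))
    have e : η * (‖u‖ - η⁻¹ * ‖v‖) ^ 2 = η * ‖u‖ ^ 2 + η⁻¹ * ‖v‖ ^ 2 - 2 * ‖u‖ * ‖v‖ := by
      field_simp; ring
    linarith
  linarith [add_sq ‖u‖ ‖v‖]

section Determinant

variable {n : ℕ} {γ : ℂ → Matrix (Fin n) (Fin n) ℂ}

theorem exists_sum_norm_inv_col_sq_le {s : Set ℂ} (hs : IsCompact s) (hγ : ContinuousOn γ s)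
    (hinv : ∀ z ∈ s, IsUnit (γ z)) :
    ∃ b : ℝ, 0 ≤ b ∧ ∀ z ∈ s, ∀ l, ∑ i, ‖(γ z)⁻¹ i l‖ ^ 2 ≤ b := by
  have hc := continuousOn_inv hγ hinv
  have hcont : ContinuousOn (fun z => ∑ l, ∑ i, ‖(γ z)⁻¹ i l‖ ^ 2) s :=
    continuousOn_finsetSum _ fun l _ => continuousOn_finsetSum _ fun i _ =>
      ((continuous_apply_apply i l).comp_continuousOn hc).norm.pow 2
  obtain ⟨B, hB⟩ := hs.exists_bound_of_continuousOn hcont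
  refine ⟨|B|, abs_nonneg _, fun z hz l => ?_⟩
  calc ∑ i, ‖(γ z)⁻¹ i l‖ ^ 2 ≤ ∑ l, ∑ i, ‖(γ z)⁻¹ i l‖ ^ 2 :=
        Finset.single_le_sum (f := fun l => ∑ i, ‖(γ z)⁻¹ i l‖ ^ 2)
          (fun l _ => by positivity) (Finset.mem_univ l)
    _ ≤ |B| := (le_abs_self _).trans ((hB z hz).trans (le_abs_self B))

/-- A Toeplitz determinant with a left null vector up to an error `ε` is bounded by `ε` times the
product of the determinants of the symbol at equidistant nodes, up to lower order factors. -/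
theorem norm_toeplitzDet_le_of_vecMul_le (hγ : ContinuousOn γ (Metric.sphere 0 1))
    (hinv : ∀ z ∈ Metric.sphere (0 : ℂ) 1, IsUnit (γ z)) {η : ℝ} (hη : 0 < η) (hη1 : η ≤ 1) :
    ∃ c : ℝ, 0 < c ∧ ∀ (N : ℕ) (x : Fin (N + 1) × Fin n → ℂ) (k : Fin (N + 1) × Fin n) (ε : ℝ),
      x k = 1 → 0 < ε → (∀ p, ‖Matrix.vecMul x (toeplitzMatrix γ N) p‖ ≤ ε) →
      ‖toeplitzDet γ N‖ ≤ c * ε * Real.exp ((N + 1) * (η * (n + 3))) *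
        ∏ j : Fin (N + 1), ‖(γ (circleNode N j)).det‖ := by
  have hcpt : IsCompact (Metric.sphere (0 : ℂ) 1) := isCompact_sphere 0 1
  obtain ⟨K, hK, hKb⟩ := exists_sum_norm_inv_mul_sq_le hcpt hγ hinv hη
  obtain ⟨b, hb, hbb⟩ := exists_sum_norm_inv_col_sq_le hcpt hγ hinv
  set σ : ℝ := η / (1 + b * n) with hσ
  have hσ0 : 0 < σ := by positivity
  have hσb : (1 + η⁻¹) * (σ ^ 2 * b * n) ≤ 2 * η := by
    have h1 : σ ^ 2 * (b * n) ≤ η ^ 2 := by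
      have hbn : 0 ≤ b * n := by positivity
      rw [hσ, div_pow, div_mul_eq_mul_div, div_le_iff₀ (by positivity)]
      refine mul_le_mul_of_nonneg_left ?_ (by positivity)
      nlinarith
    calc (1 + η⁻¹) * (σ ^ 2 * b * n) = (1 + η⁻¹) * (σ ^ 2 * (b * n)) := by ring
      _ ≤ (1 + η⁻¹) * η ^ 2 := by gcongr
      _ = η ^ 2 + η := by field_simp
      _ ≤ 2 * η := by nlinarith
  refine ⟨σ⁻¹ * Real.exp (4 * K), by positivity, fun N x k ε hx hε hr => ?_⟩
  have hN : (0 : ℝ) < N + 1 := by positivity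
  set A := toeplitzMatrix γ N with hA
  set S := preconditioner γ N with hS
  set r := Matrix.vecMul x A with hrdef
  set s : ℝ := σ / ε with hs
  have hs0 : 0 < s := by positivity
  set A' := A + (s : ℂ) • Matrix.vecMulVec (Pi.single k 1) r with hA'
  have hdet : A'.det = (1 + s) * A.det := det_add_vecMulVec_vecMul A x hx s
  have hSA' : ∀ p q, (S * A') p q = (S * A) p q + (s : ℂ) * (S p k * r q) := by
    intro p q
    rw [hA', mul_add, Matrix.mul_smul, Matrix.mul_vecMulVec, Matrix.mulVec_single_one]
    simp [Matrix.vecMulVec_apply]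
  have hpert : ∑ p, ∑ q, ‖(s : ℂ) * (S p k * r q)‖ ^ 2 ≤ (N + 1) * (σ ^ 2 * b * n) := by
    have e : ∑ p, ∑ q, ‖(s : ℂ) * (S p k * r q)‖ ^ 2 =
        s ^ 2 * ((∑ p, ‖S p k‖ ^ 2) * ∑ q, ‖r q‖ ^ 2) := by
      rw [Finset.sum_mul_sum, Finset.mul_sum]
      refine Finset.sum_congr rfl fun p _ => ?_
      rw [Finset.mul_sum]
      refine Finset.sum_congr rfl fun q _ => ?_
      rw [norm_mul, norm_mul, Complex.norm_real, Real.norm_eq_abs, abs_of_pos hs0]; ring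
    have h1 : ∑ p, ‖S p k‖ ^ 2 ≤ b := sum_norm_preconditioner_col_sq_le hbb N k
    have h2 : ∑ q, ‖r q‖ ^ 2 ≤ (N + 1) * n * ε ^ 2 := by
      refine (Finset.sum_le_sum fun q _ =>
        pow_le_pow_left₀ (norm_nonneg _) (hr q) 2).trans (le_of_eq ?_)
      simp
    rw [e]
    calc _ ≤ s ^ 2 * (b * ((N + 1) * n * ε ^ 2)) := by gcongr
      _ = _ := by rw [hs]; field_simp
  have hfro := sum_norm_preconditioner_mul_toeplitzMatrix_sq_le hγ hK hKb N
  have htot : ∑ p, ∑ q, ‖(S * A') p q‖ ^ 2 ≤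
      Fintype.card (Fin (N + 1) × Fin n) + ((N + 1) * (2 * (η * (n + 3))) + 8 * K) := by
    calc ∑ p, ∑ q, ‖(S * A') p q‖ ^ 2 ≤ ∑ p, ∑ q, ((1 + η) * ‖(S * A) p q‖ ^ 2 +
          (1 + η⁻¹) * ‖(s : ℂ) * (S p k * r q)‖ ^ 2) :=
          Finset.sum_le_sum fun p _ => Finset.sum_le_sum fun q _ => by
            rw [hSA']; exact norm_add_sq_le_weighted _ _ hη
      _ = (1 + η) * ∑ p, ∑ q, ‖(S * A) p q‖ ^ 2 +
          (1 + η⁻¹) * ∑ p, ∑ q, ‖(s : ℂ) * (S p k * r q)‖ ^ 2 := by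
          simp only [Finset.sum_add_distrib, Finset.mul_sum]
      _ ≤ (1 + η) * ((N + 1) * (n + η) + 4 * K) + (1 + η⁻¹) * ((N + 1) * (σ ^ 2 * b * n)) := by
          gcongr
      _ ≤ (1 + η) * ((N + 1) * (n + η) + 4 * K) + (N + 1) * (2 * η) := by
          have := mul_le_mul_of_nonneg_left hσb hN.le
          linarith
      _ ≤ _ := by
          have h1 : η * η ≤ η := by nlinarith
          have h2 : (N + 1 : ℝ) * (η * η) ≤ (N + 1) * η := by gcongr
          have h3 : η * K ≤ 1 * K := by gcongr
          have h4 : 0 ≤ (N + 1 : ℝ) * (η * n) := by positivity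
          have h5 : 0 ≤ (N + 1 : ℝ) * η := by positivity
          simp only [Fintype.card_prod, Fintype.card_fin]
          push_cast
          linarith
  have hexp := norm_det_sq_le_exp _ htot
  have hexp' : ‖(S * A').det‖ ≤ Real.exp ((N + 1) * (η * (n + 3)) + 4 * K) := by
    refine (sq_le_sq₀ (norm_nonneg _) (Real.exp_pos _).le).1 ?_
    rw [← Real.exp_nat_mul]
    refine hexp.trans (le_of_eq ?_)
    congr 1
    push_cast
    ring
  set P := ∏ j : Fin (N + 1), ‖(γ (circleNode N j)).det‖ with hP
  have hPpos : 0 < P := Finset.prod_pos fun j _ => norm_pos_iff.2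
    ((Matrix.isUnit_iff_isUnit_det _).1 (hinv _ (circleNode_mem_sphere N j))).ne_zero
  rw [Matrix.det_mul, norm_mul, hdet, hS, norm_det_preconditioner, Finset.prod_inv_distrib,
    norm_mul] at hexp'
  have h1s : ‖(1 + s : ℂ)‖ = 1 + s := by
    rw [← Complex.ofReal_one, ← Complex.ofReal_add, Complex.norm_real, Real.norm_eq_abs,
      abs_of_pos (by linarith)]
  rw [h1s, inv_mul_le_iff₀ hPpos] at hexp'
  have hfin : s * ‖A.det‖ ≤ P * Real.exp ((N + 1) * (η * (n + 3)) + 4 * K) :=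
    le_trans (by gcongr; linarith) hexp'
  rw [Real.exp_add] at hfin
  change ‖A.det‖ ≤ _
  rw [hs, div_mul_eq_mul_div, div_le_iff₀ hε] at hfin
  rw [← mul_le_mul_iff_right₀ hσ0]
  refine hfin.trans (le_of_eq ?_)
  field_simp

theorem norm_geometricMean {ℓ : ℝ → ℂ} (hℓ : IsLogDetBranch γ ℓ) :
    ‖geometricMean γ‖ = Real.exp ((2 * π)⁻¹ * ∫ θ in (0 : ℝ)..(2 * π), (ℓ θ).re) := by
  have hi : IntervalIntegrable ℓ MeasureTheory.volume 0 (2 * π) := by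
    refine ContinuousOn.intervalIntegrable ?_
    rw [Set.uIcc_of_le (by positivity)]
    exact hℓ.1
  have h : ∫ θ in (0 : ℝ)..(2 * π), (ℓ θ).re = (∫ θ in (0 : ℝ)..(2 * π), ℓ θ).re :=
    Complex.reCLM.intervalIntegral_comp_comm hi
  rw [geometricMean_eq hℓ, Complex.norm_exp, h]
  congr 1
  rw [show (2 * (π : ℂ))⁻¹ = (((2 * π)⁻¹ : ℝ) : ℂ) by push_cast; rfl, Complex.re_ofReal_mul]

theorem tendsto_toeplitzDet_div_zero (hγ : ContinuousOn γ (Metric.sphere 0 1))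
    (hinv : ∀ z ∈ Metric.sphere (0 : ℂ) 1, IsUnit (γ z)) {ℓ : ℝ → ℂ} (hℓ : IsLogDetBranch γ ℓ)
    (x : ℕ → Fin n → ℂ) {q₀ : ℕ} {i₀ : Fin n} (hx : x q₀ i₀ = 1) {C ρ : ℝ} (hC : 0 < C)
    (hρ0 : 0 < ρ) (hρ1 : ρ < 1)
    (hr : ∀ N p : ℕ, ∀ l : Fin n, ‖∑ q ∈ Finset.range (N + 1), ∑ i,
      x q i * laurentCoeff γ ((q : ℤ) - (p : ℤ)) i l‖ ≤ C * ρ ^ N) :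
    Tendsto (fun N : ℕ => toeplitzDet γ N / geometricMean γ ^ (N + 1)) atTop (𝓝 0) := by
  obtain ⟨η, hη, hη1, hηρ⟩ : ∃ η : ℝ, 0 < η ∧ η ≤ 1 ∧ Real.exp (η * (n + 4)) * ρ < 1 := by
    have ht : Tendsto (fun η : ℝ => Real.exp (η * (n + 4)) * ρ) (𝓝[>] 0) (𝓝 ρ) := by
      have : Continuous (fun η : ℝ => Real.exp (η * (n + 4)) * ρ) := by fun_prop
      simpa using (this.tendsto 0).mono_left nhdsWithin_le_nhds
    obtain ⟨η, h1, h2, h3⟩ := ((ht.eventually (gt_mem_nhds hρ1)).and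
      (Ioc_mem_nhdsGT (zero_lt_one' ℝ))).exists
    exact ⟨η, h2, h3, h1⟩
  obtain ⟨c, hc, hbound⟩ := norm_toeplitzDet_le_of_vecMul_le hγ hinv hη hη1
  have hre : ContinuousOn (fun θ => (ℓ θ).re) (Set.Icc 0 (2 * π)) :=
    Complex.continuous_re.comp_continuousOn hℓ.1
  set κ := Real.exp (η * (n + 4)) * ρ with hκ
  have hκ0 : 0 ≤ κ := by positivity
  have hlim : Tendsto (fun N : ℕ => c * C * Real.exp (η * (n + 4)) * κ ^ N) atTop (𝓝 0) := by
    simpa using (tendsto_pow_atTop_nhds_zero_of_lt_one hκ0 hηρ).const_mul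
      (c * C * Real.exp (η * (n + 4)))
  refine squeeze_zero_norm' ?_ hlim
  filter_upwards [eventually_sum_le_mul_average_add hre hη, eventually_ge_atTop q₀] with N hsum hN
  have hvec : ∀ p, ‖Matrix.vecMul (fun q : Fin (N + 1) × Fin n => x q.1 q.2)
      (toeplitzMatrix γ N) p‖ ≤ C * ρ ^ N := by
    rintro ⟨p, l⟩
    refine le_trans (le_of_eq ?_) (hr N p l)
    rw [← Fin.sum_univ_eq_sum_range (fun q => ∑ i, x q i * laurentCoeff γ ((q : ℤ) - (p : ℕ)) i l)]
    rw [Matrix.vecMul, dotProduct, Fintype.sum_prod_type]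
    rfl
  have h1 := hbound N _ (⟨q₀, Nat.lt_succ_of_le hN⟩, i₀) (C * ρ ^ N) hx (by positivity) hvec
  have hprod : ∏ j : Fin (N + 1), ‖(γ (circleNode N j)).det‖ ≤
      ‖geometricMean γ‖ ^ (N + 1) * Real.exp ((N + 1) * η) := by
    have e : ∀ j : Fin (N + 1), ‖(γ (circleNode N j)).det‖ =
        Real.exp ((ℓ (2 * π * (j : ℕ) / (N + 1))).re) := by
      intro j
      rw [← Complex.norm_exp, hℓ.2 _ ?_]
      · rfl
      · refine ⟨by positivity, ?_⟩
        rw [div_le_iff₀ (by positivity)]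
        have : ((j : ℕ) : ℝ) ≤ N + 1 := by exact_mod_cast j.2.le
        gcongr
    rw [Finset.prod_congr rfl fun j _ => e j, ← Real.exp_sum, norm_geometricMean hℓ,
      ← Real.exp_nat_mul, ← Real.exp_add, Real.exp_le_exp]
    refine hsum.trans (le_of_eq ?_)
    push_cast
    ring
  have hG : 0 < ‖geometricMean γ‖ ^ (N + 1) := by
    rw [norm_geometricMean hℓ]; positivity
  rw [norm_div, norm_pow, div_le_iff₀ hG]
  calc ‖toeplitzDet γ N‖ ≤ c * (C * ρ ^ N) * Real.exp ((N + 1) * (η * (n + 3))) *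
        (‖geometricMean γ‖ ^ (N + 1) * Real.exp ((N + 1) * η)) :=
        h1.trans (by gcongr)
    _ = c * C * ρ ^ N * Real.exp ((N + 1) * (η * (n + 4))) * ‖geometricMean γ‖ ^ (N + 1) := by
        rw [show (N + 1 : ℝ) * (η * (n + 4)) = (N + 1) * (η * (n + 3)) + (N + 1) * η by ring,
          Real.exp_add]
        ring
    _ = _ := by
        rw [hκ, mul_pow, ← Real.exp_nat_mul,
          show (N + 1 : ℝ) * (η * (n + 4)) = η * (n + 4) + N * (η * (n + 4)) by ring, Real.exp_add]
        ring

end Determinant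

end BlockToeplitz

namespace BlockToeplitz

open Real Filter Topology

theorem norm_circleAverage_le {f : ℂ → ℂ} {R B : ℝ} (hR : 0 ≤ R)
    (hf : ∀ z ∈ Metric.sphere (0 : ℂ) R, ‖f z‖ ≤ B) : ‖circleAverage f 0 R‖ ≤ B := by
  rw [circleAverage_def, norm_smul, norm_inv, Real.norm_eq_abs, abs_of_pos Real.two_pi_pos,
    inv_mul_le_iff₀ Real.two_pi_pos]
  refine (intervalIntegral.norm_integral_le_of_norm_le_const (C := B) fun θ _ =>
    hf _ (circleMap_mem_sphere 0 hR θ)).trans (le_of_eq ?_)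
  rw [sub_zero, abs_of_pos Real.two_pi_pos, mul_comm]

/-- A function analytic outside the unit disc that vanishes at infinity becomes, after the
inversion of the plane, a function analytic in the disc. -/
theorem diffContOnCl_comp_inv {f : ℂ → ℂ} (hf : DiffContOnCl ℂ f (Metric.closedBall 0 1)ᶜ)
    (h0 : Tendsto f (cocompact ℂ) (𝓝 0)) :
    DiffContOnCl ℂ (fun w => if w = 0 then 0 else f w⁻¹) (Metric.ball 0 1) := by
  set g : ℂ → ℂ := fun w => if w = 0 then 0 else f w⁻¹ with hg
  have hgf : ∀ w ≠ 0, g =ᶠ[𝓝 w] fun w => f w⁻¹ := fun w hw => by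
    filter_upwards [isOpen_ne.mem_nhds hw] with v hv
    exact if_neg hv
  have hcl : closure (Metric.closedBall (0 : ℂ) 1)ᶜ = (Metric.ball 0 1)ᶜ := by
    rw [closure_compl, interior_closedBall _ one_ne_zero]
  have hdiff : ∀ w ∈ Metric.ball (0 : ℂ) 1, w ≠ 0 → DifferentiableAt ℂ g w := by
    intro w hw hw0
    refine DifferentiableAt.congr_of_eventuallyEq ?_ (hgf w hw0)
    have hmem : w⁻¹ ∈ (Metric.closedBall (0 : ℂ) 1)ᶜ := by
      simp only [Set.mem_compl_iff, mem_closedBall_zero_iff, norm_inv, not_le]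
      exact (one_lt_inv₀ (norm_pos_iff.2 hw0)).2 (mem_ball_zero_iff.1 hw)
    exact (hf.differentiableAt Metric.isClosed_closedBall.isOpen_compl hmem).comp w
      (differentiableAt_inv hw0)
  have hcont0 : ContinuousAt g 0 := by
    rw [continuousAt_iff_punctured_nhds]
    have h1 : Tendsto (fun w : ℂ => f w⁻¹) (𝓝[≠] 0) (𝓝 0) :=
      h0.comp (Metric.cobounded_eq_cocompact (α := ℂ) ▸ Filter.tendsto_inv₀_nhdsNE_zero)
    have h2 : g 0 = 0 := if_pos rfl
    rw [h2]
    refine h1.congr' ?_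
    filter_upwards [self_mem_nhdsWithin] with w hw
    exact (if_neg hw).symm
  refine ⟨fun w hw => ?_, ?_⟩
  · by_cases hw0 : w = 0
    · subst hw0
      refine (Complex.analyticAt_of_differentiable_on_punctured_nhds_of_continuousAt ?_
        hcont0).differentiableAt.differentiableWithinAt
      filter_upwards [self_mem_nhdsWithin, mem_nhdsWithin_of_mem_nhds
        (Metric.isOpen_ball.mem_nhds hw)] with v hv hv1
      exact hdiff v hv1 hv
    · exact (hdiff w hw hw0).differentiableWithinAt
  · rw [closure_ball _ one_ne_zero]
    intro w hw
    by_cases hw0 : w = 0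
    · subst hw0; exact hcont0.continuousWithinAt
    · refine ContinuousWithinAt.congr_of_eventuallyEq ?_
        ((hgf w hw0).filter_mono nhdsWithin_le_nhds) (hgf w hw0).eq_of_nhds
      have hmaps : ∀ v ∈ Metric.closedBall (0 : ℂ) 1 ∩ {0}ᶜ,
          v⁻¹ ∈ closure (Metric.closedBall (0 : ℂ) 1)ᶜ := by
        intro v hv
        rw [hcl]
        simp only [Set.mem_compl_iff, mem_ball_zero_iff, norm_inv, not_lt]
        exact (one_le_inv₀ (norm_pos_iff.2 hv.2)).2 (mem_closedBall_zero_iff.1 hv.1)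
      have h1 : ContinuousWithinAt (fun w : ℂ => f w⁻¹) (Metric.closedBall 0 1 ∩ {0}ᶜ) w :=
        (hf.continuousOn _ (hmaps w ⟨hw, hw0⟩)).comp
          (continuousAt_inv₀ hw0).continuousWithinAt hmaps
      rwa [continuousWithinAt_inter (isOpen_compl_singleton.mem_nhds hw0)] at h1

/-- The Taylor series of a function in the disc algebra converges on the closed disc if its
coefficients decay geometrically. -/
theorem hasSum_circleAverage_mul_pow {g : ℂ → ℂ} (hg : DiffContOnCl ℂ g (Metric.ball 0 1))
    {B ρ : ℝ} (hρ0 : 0 ≤ ρ) (hρ1 : ρ < 1)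
    (hB : ∀ k : ℕ, ‖circleAverage (fun z => z ^ (-(k : ℤ)) * g z) 0 1‖ ≤ B * ρ ^ k) {w : ℂ}
    (hw : ‖w‖ ≤ 1) :
    HasSum (fun k : ℕ => circleAverage (fun z => z ^ (-(k : ℤ)) * g z) 0 1 * w ^ k) (g w) := by
  set a : ℕ → ℂ := fun k => circleAverage (fun z => z ^ (-(k : ℤ)) * g z) 0 1 with ha
  have hsumm : Summable fun k : ℕ => B * ρ ^ k :=
    (summable_geometric_of_lt_one hρ0 hρ1).mul_left B
  have hle : ∀ k, ∀ v ∈ Metric.closedBall (0 : ℂ) 1, ‖a k * v ^ k‖ ≤ B * ρ ^ k := by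
    intro k v hv
    rw [norm_mul, norm_pow]
    exact (mul_le_of_le_one_right (norm_nonneg _)
      (pow_le_one₀ (norm_nonneg _) (mem_closedBall_zero_iff.1 hv))).trans (hB k)
  have hcont : ContinuousOn (fun v => ∑' k, a k * v ^ k) (Metric.closedBall 0 1) :=
    continuousOn_tsum (fun k => by fun_prop) hsumm hle
  have hin : Set.EqOn (fun v => ∑' k, a k * v ^ k) g (Metric.ball 0 1) := by
    intro v hv
    have h := (DiffContOnCl.hasFPowerSeriesOnBall (R := 1) (by simpa using hg)
      zero_lt_one).hasSum (y := v) (by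
        rw [Metric.mem_eball, edist_zero_right, ENNReal.coe_one, ← ofReal_norm,
          ENNReal.ofReal_lt_one]
        exact mem_ball_zero_iff.1 hv)
    rw [zero_add] at h
    rw [← h.tsum_eq]
    refine tsum_congr fun k => ?_
    rw [cauchyPowerSeries_apply, ha]
    simp only
    rw [circleAverage_eq_circleIntegral one_ne_zero, mul_comm, smul_eq_mul, smul_eq_mul,
      mul_left_comm, ← circleIntegral.integral_const_mul]
    congr 1
    refine circleIntegral.integral_congr (by simp) fun z _ => ?_
    simp only [sub_zero, smul_eq_mul, zpow_neg, zpow_natCast, div_pow]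
    ring
  have hcl : closure (Metric.ball (0 : ℂ) 1) = Metric.closedBall 0 1 := closure_ball _ one_ne_zero
  have heq := hin.of_subset_closure hcont (hcl ▸ hg.continuousOn) Metric.ball_subset_closedBall
    hcl.ge
  have hwm : w ∈ Metric.closedBall (0 : ℂ) 1 := mem_closedBall_zero_iff.2 hw
  rw [← heq hwm]
  exact (Summable.of_norm_bounded hsumm fun k => hle k w hwm).hasSum

section SymbolInverse

variable {n : ℕ} {γ : ℂ → Matrix (Fin n) (Fin n) ℂ}

theorem analyticAt_det {M : ℂ → Matrix (Fin n) (Fin n) ℂ} {z : ℂ}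
    (hM : ∀ i j, AnalyticAt ℂ (fun z => M z i j) z) : AnalyticAt ℂ (fun z => (M z).det) z := by
  simp only [Matrix.det_apply']
  exact Finset.analyticAt_fun_sum _ fun σ _ => analyticAt_const.mul
    (Finset.analyticAt_fun_prod _ fun i _ => hM _ _)

theorem analyticAt_inv_apply {z : ℂ} (hγ : ∀ i j, AnalyticAt ℂ (fun z => γ z i j) z)
    (hdet : (γ z).det ≠ 0) (i j : Fin n) : AnalyticAt ℂ (fun z => (γ z)⁻¹ i j) z := by
  simp only [Matrix.inv_def, Ring.inverse_eq_inv', Matrix.smul_apply, smul_eq_mul,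
    Matrix.adjugate_apply]
  refine ((analyticAt_det hγ).inv hdet).mul (analyticAt_det fun k l => ?_)
  by_cases hk : k = j
  · subst hk; simpa using analyticAt_const
  · simpa [Matrix.updateRow_ne hk] using hγ k l

theorem exists_annulus_analyticAt_inv
    (hγ : ∀ i j, AnalyticOnNhd ℂ (fun z => γ z i j) (Metric.sphere 0 1))
    (hinv : ∀ z ∈ Metric.sphere (0 : ℂ) 1, IsUnit (γ z)) :
    ∃ r : ℝ, 0 < r ∧ r < 1 ∧ ∀ z : ℂ, r ≤ ‖z‖ → ‖z‖ ≤ 1 →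
      ∀ i j, AnalyticAt ℂ (fun z => (γ z)⁻¹ i j) z := by
  set U : Set ℂ := {z | ∀ i j, AnalyticAt ℂ (fun z => (γ z)⁻¹ i j) z} with hU
  have hmem : U ∈ 𝓝ˢ (Metric.sphere (0 : ℂ) 1) := by
    rw [mem_nhdsSet_iff_forall]
    intro z hz
    have h : ∀ i j, ∀ᶠ w in 𝓝 z, AnalyticAt ℂ (fun z => (γ z)⁻¹ i j) w := fun i j =>
      (analyticAt_inv_apply (fun i j => hγ i j z hz)
        ((Matrix.isUnit_iff_isUnit_det _).1 (hinv z hz)).ne_zero i j).eventually_analyticAt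
    exact eventually_all.2 fun i => eventually_all.2 (h i)
  obtain ⟨δ, hδ, hsub⟩ := (isCompact_sphere (0 : ℂ) 1).exists_cthickening_subset_open
    isOpen_interior (subset_interior_iff_mem_nhdsSet.2 hmem)
  refine ⟨max (1 - δ) (1 / 2), by positivity, max_lt (by linarith) (by norm_num),
    fun z hz hz1 => ?_⟩
  have hzpos : 0 < ‖z‖ := lt_of_lt_of_le (by positivity) hz
  refine interior_subset (hsub (Metric.mem_cthickening_of_dist_le z ((‖z‖⁻¹ : ℝ) * z) δ _ ?_ ?_))
  · simp [hzpos.ne']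
  · rw [dist_eq_norm]
    have e : z - ((‖z‖⁻¹ : ℝ) : ℂ) * z = ((1 - ‖z‖⁻¹ : ℝ) : ℂ) * z := by push_cast; ring
    rw [e, norm_mul, Complex.norm_real, Real.norm_eq_abs, abs_sub_comm,
      abs_of_nonneg (sub_nonneg.2 ((one_le_inv₀ hzpos).2 hz1)), sub_mul,
      inv_mul_cancel₀ hzpos.ne']
    linarith [le_max_left (1 - δ) (1 / 2)]

/-- Moving the contour inwards makes averages against `z ^ k` geometrically small. -/
theorem exists_norm_circleAverage_pow_mul_le {H : ℂ → ℂ} {r : ℝ} (hr0 : 0 < r) (hr1 : r < 1)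
    (hc : ContinuousOn H (Metric.closedBall 0 1 \ Metric.ball 0 r))
    (hd : ∀ z ∈ Metric.ball (0 : ℂ) 1 \ Metric.closedBall 0 r, DifferentiableAt ℂ H z) :
    ∃ B : ℝ, 0 < B ∧ ∀ k : ℕ, ‖circleAverage (fun z => z ^ k * H z) 0 1‖ ≤ B * r ^ k := by
  have hsub : Metric.sphere (0 : ℂ) r ⊆ Metric.closedBall 0 1 \ Metric.ball 0 r := by
    intro z hz
    rw [mem_sphere_zero_iff_norm] at hz
    simp [hz, hr1.le]
  obtain ⟨B, hB⟩ := (isCompact_sphere (0 : ℂ) r).exists_bound_of_continuousOn (hc.mono hsub)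
  refine ⟨|B| + 1, by positivity, fun k => ?_⟩
  have h : circleAverage (fun z => z ^ k * H z) 0 1 = circleAverage (fun z => z ^ k * H z) 0 r := by
    rw [circleAverage_eq_circleIntegral one_ne_zero, circleAverage_eq_circleIntegral hr0.ne']
    congr 1
    refine Complex.circleIntegral_sub_center_inv_smul_eq_of_differentiable_on_annulus_off_countable
      hr0 hr1.le Set.countable_empty ((continuousOn_pow k).mul hc) fun z hz => ?_
    exact (differentiableAt_pow k).mul (hd z hz.1)
  rw [h]
  refine norm_circleAverage_le hr0.le fun z hz => ?_
  rw [norm_mul, norm_pow, mem_sphere_zero_iff_norm.1 hz, mul_comm]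
  gcongr
  exact (hB z hz).trans ((le_abs_self B).trans (by linarith))

end SymbolInverse

end BlockToeplitz

namespace BlockToeplitz

open Real Filter Topology

section HomogeneousProblem

variable {n : ℕ} {γ : ℂ → Matrix (Fin n) (Fin n) ℂ}

/-- The Taylor coefficients at infinity of `φ₋` in a solution of the homogeneous problem decay
geometrically. -/
theorem exists_coeff_of_homogeneous
    (hγ : ∀ i j, AnalyticOnNhd ℂ (fun z => γ z i j) (Metric.sphere 0 1))
    (hinv : ∀ z ∈ Metric.sphere (0 : ℂ) 1, IsUnit (γ z)) {F f : Fin n → ℂ → ℂ}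
    (hF : ∀ i, DiffContOnCl ℂ (F i) (Metric.ball 0 1))
    (hf : ∀ i, DiffContOnCl ℂ (f i) (Metric.closedBall 0 1)ᶜ)
    (hjump : ∀ z ∈ Metric.sphere (0 : ℂ) 1, ∀ l, F l z = ∑ i, γ z i l * f i z)
    (hf0 : ∀ i, Tendsto (f i) (cocompact ℂ) (𝓝 0)) :
    ∃ (a : Fin n → ℕ → ℂ) (B r : ℝ), 0 < B ∧ 0 < r ∧ r < 1 ∧ (∀ i k, ‖a i k‖ ≤ B * r ^ k) ∧
      (∀ i, a i 0 = 0) ∧ ∀ i z, 1 ≤ ‖z‖ → HasSum (fun k => a i k * z⁻¹ ^ k) (f i z) := by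
  obtain ⟨r, hr0, hr1, hr⟩ := exists_annulus_analyticAt_inv hγ hinv
  set H : Fin n → ℂ → ℂ := fun i z => ∑ l, (γ z)⁻¹ l i * F l z with hH
  have hHf : ∀ i, ∀ z ∈ Metric.sphere (0 : ℂ) 1, H i z = f i z := by
    intro i z hz
    have h1 : γ z * (γ z)⁻¹ = 1 :=
      Matrix.mul_nonsing_inv _ ((Matrix.isUnit_iff_isUnit_det _).1 (hinv z hz))
    simp only [hH, hjump z hz, Finset.mul_sum]
    rw [Finset.sum_comm]
    calc ∑ j, ∑ l, (γ z)⁻¹ l i * (γ z j l * f j z) = ∑ j, (γ z * (γ z)⁻¹) j i * f j z := by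
          refine Finset.sum_congr rfl fun j _ => ?_
          rw [Matrix.mul_apply, Finset.sum_mul]
          exact Finset.sum_congr rfl fun l _ => by ring
      _ = f i z := by rw [h1]; simp [Matrix.one_apply]
  have hHc : ∀ i, ContinuousOn (H i) (Metric.closedBall 0 1 \ Metric.ball 0 r) := by
    intro i
    refine continuousOn_finsetSum _ fun l _ => ContinuousOn.mul (fun z hz => ?_)
      ((hF l).continuousOn_ball.mono Set.sdiff_subset)
    exact (hr z (by simpa using hz.2) (by simpa using hz.1) l i).continuousAt.continuousWithinAt
  have hHd : ∀ i, ∀ z ∈ Metric.ball (0 : ℂ) 1 \ Metric.closedBall 0 r,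
      DifferentiableAt ℂ (H i) z := by
    intro i z hz
    have hz1 := hz.1
    have hz2 := hz.2
    simp only [mem_ball_zero_iff, mem_closedBall_zero_iff, not_le] at hz1 hz2
    exact DifferentiableAt.fun_sum fun l _ => (hr z hz2.le hz1.le l i).differentiableAt.mul
      ((hF l).differentiableAt Metric.isOpen_ball hz.1)
  choose B hB0 hB using fun i => exists_norm_circleAverage_pow_mul_le hr0 hr1 (hHc i) (hHd i)
  set g : Fin n → ℂ → ℂ := fun i w => if w = 0 then 0 else f i w⁻¹ with hg
  have hgd : ∀ i, DiffContOnCl ℂ (g i) (Metric.ball 0 1) := fun i =>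
    diffContOnCl_comp_inv (hf i) (hf0 i)
  set a : Fin n → ℕ → ℂ := fun i k => circleAverage (fun z => z ^ (-(k : ℤ)) * g i z) 0 1 with ha
  have haH : ∀ i k, a i k = circleAverage (fun z => z ^ k * H i z) 0 1 := by
    intro i k
    rw [ha, ← circleAverage_zero_one_congr_inv (f := fun z => z ^ k * H i z)]
    refine circleAverage_congr_sphere fun z hz => ?_
    rw [abs_one] at hz
    have hz0 : z ≠ 0 := Metric.ne_of_mem_sphere hz one_ne_zero
    simp only [hg, if_neg hz0]
    rw [hHf i z⁻¹ (by simpa using hz), zpow_neg, zpow_natCast, inv_pow]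
  set B' : ℝ := 1 + ∑ i, B i with hB'
  have hB'0 : 0 < B' := by
    have : 0 ≤ ∑ i, B i := Finset.sum_nonneg fun i _ => (hB0 i).le
    linarith
  have hle : ∀ i k, ‖a i k‖ ≤ B' * r ^ k := by
    intro i k
    rw [haH]
    refine (hB i k).trans ?_
    gcongr
    have := Finset.single_le_sum (f := B) (fun i _ => (hB0 i).le) (Finset.mem_univ i)
    linarith
  refine ⟨a, B', r, hB'0, hr0, hr1, hle, fun i => ?_, fun i z hz => ?_⟩
  · simp only [ha, Nat.cast_zero, neg_zero, zpow_zero, one_mul]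
    rw [DiffContOnCl.circleAverage (by simpa using hgd i)]
    exact if_pos rfl
  · have hz0 : z ≠ 0 := norm_pos_iff.1 (by linarith)
    have h := hasSum_circleAverage_mul_pow (hgd i) hr0.le hr1 (hle i) (w := z⁻¹)
      (by rw [norm_inv]; exact inv_le_one_of_one_le₀ hz)
    have e : g i z⁻¹ = f i z := by simp [hg, hz0]
    rwa [e] at h

theorem continuousOn_of_analyticOnNhd
    (hγ : ∀ i j, AnalyticOnNhd ℂ (fun z => γ z i j) (Metric.sphere 0 1)) :
    ContinuousOn γ (Metric.sphere 0 1) :=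
  continuousOn_pi.2 fun i => continuousOn_pi.2 fun j => (hγ i j).continuousOn

/-- The truncated Taylor coefficients of `φ₋` at infinity are left null vectors of the Toeplitz
matrices up to a geometrically small error. -/
theorem exists_norm_sum_coeff_mul_laurentCoeff_le (hγ : ContinuousOn γ (Metric.sphere 0 1))
    {F f : Fin n → ℂ → ℂ} (hF : ∀ i, DiffContOnCl ℂ (F i) (Metric.ball 0 1))
    (hfc : ∀ i, ContinuousOn (f i) (Metric.sphere 0 1))
    (hjump : ∀ z ∈ Metric.sphere (0 : ℂ) 1, ∀ l, F l z = ∑ i, γ z i l * f i z)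
    {a : Fin n → ℕ → ℂ} {B r : ℝ} (hB : 0 < B) (hr0 : 0 < r) (hr1 : r < 1)
    (hle : ∀ i k, ‖a i k‖ ≤ B * r ^ k) (ha0 : ∀ i, a i 0 = 0)
    (hsum : ∀ i z, 1 ≤ ‖z‖ → HasSum (fun k => a i k * z⁻¹ ^ k) (f i z)) :
    ∃ C : ℝ, 0 < C ∧ ∀ N p : ℕ, ∀ l : Fin n, ‖∑ q ∈ Finset.range (N + 1), ∑ i,
      a i (q + 1) * laurentCoeff γ ((q : ℤ) - (p : ℤ)) i l‖ ≤ C * r ^ N := by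
  have hent : ∀ i l, ContinuousOn (fun z => γ z i l) (Metric.sphere 0 1) := fun i l =>
    (continuous_apply_apply i l).comp_continuousOn hγ
  obtain ⟨Γ, hΓ⟩ := (isCompact_sphere (0 : ℂ) 1).exists_bound_of_continuousOn
    (f := fun z => ∑ l, ∑ i, ‖γ z i l‖)
    (continuousOn_finsetSum _ fun l _ => continuousOn_finsetSum _ fun i _ => (hent i l).norm)
  have hcol : ∀ z ∈ Metric.sphere (0 : ℂ) 1, ∀ l, ∑ i, ‖γ z i l‖ ≤ |Γ| + 1 := by
    intro z hz l
    have h1 := Finset.single_le_sum (f := fun l => ∑ i, ‖γ z i l‖) (fun l _ => by positivity)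
      (Finset.mem_univ l)
    have h2 := (le_abs_self _).trans (hΓ z hz)
    exact h1.trans (h2.trans ((le_abs_self Γ).trans (le_add_of_nonneg_right zero_le_one)))
  have h1r : 0 < 1 - r := by linarith
  refine ⟨B / (1 - r) * (|Γ| + 1), by positivity, fun N p l => ?_⟩
  set P : Fin n → ℂ → ℂ := fun i z => ∑ k ∈ Finset.range (N + 2), a i k * z⁻¹ ^ k with hP
  have hPc : ∀ i, ContinuousOn (P i) (Metric.sphere 0 1) := fun i =>
    continuousOn_finsetSum _ fun k _ => continuousOn_const.mul
      ((continuousOn_inv₀.mono fun z hz => Metric.ne_of_mem_sphere hz one_ne_zero).pow k)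
  have hpc : ContinuousOn (fun z : ℂ => z ^ (p + 1)) (Metric.sphere 0 1) := continuousOn_pow _
  have hPf : ∀ i, ∀ z ∈ Metric.sphere (0 : ℂ) 1, ‖P i z - f i z‖ ≤ B / (1 - r) * r ^ N := by
    intro i z hz
    have hz1 : ‖z‖ = 1 := mem_sphere_zero_iff_norm.1 hz
    refine (norm_sub_le_of_geometric_bound_of_hasSum hr1 (C := B) (fun k => ?_)
      (hsum i z hz1.ge) (N + 2)).trans ?_
    · rw [norm_mul, norm_pow, norm_inv, hz1]; simpa using hle i k
    · rw [mul_div_right_comm]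
      gcongr ?_ * ?_
      exact pow_le_pow_of_le_one hr0.le hr1.le (by omega)
  have hFavg : circleAverage (fun z => z ^ (p + 1) * ∑ i, f i z * γ z i l) 0 1 = 0 := by
    have hd : DiffContOnCl ℂ (fun z => z ^ (p + 1) * F l z) (Metric.ball 0 |1|) := by
      rw [abs_one]
      exact ((differentiable_pow (p + 1)).diffContOnCl).smul (hF l)
    have h := hd.circleAverage
    rw [zero_pow (Nat.succ_ne_zero p), zero_mul] at h
    refine Eq.trans (circleAverage_congr_sphere fun z hz => ?_) h
    rw [abs_one] at hz
    rw [hjump z hz l]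
    exact congrArg _ (Finset.sum_congr rfl fun i _ => mul_comm _ _)
  have hPavg : ∑ q ∈ Finset.range (N + 1), ∑ i,
      a i (q + 1) * laurentCoeff γ ((q : ℤ) - (p : ℤ)) i l =
      circleAverage (fun z => z ^ (p + 1) * ∑ i, P i z * γ z i l) 0 1 := by
    rw [circleAverage_congr_sphere (f₂ := fun z => ∑ q ∈ Finset.range (N + 1), ∑ i,
      a i (q + 1) * (z ^ (-((q : ℤ) - (p : ℤ))) * γ z i l)), circleAverage_fun_sum]
    · refine Finset.sum_congr rfl fun q _ => ?_
      rw [circleAverage_fun_sum]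
      · refine Finset.sum_congr rfl fun i _ => ?_
        rw [circleAverage_const_mul, ← laurentCoeff_eq_circleAverage]
      · intro i _
        exact (continuousOn_const.mul ((continuousOn_zpow_sphere _).mul
          (hent _ _))).circleIntegrable_one
    · intro q _
      exact (continuousOn_finsetSum _ fun i _ => continuousOn_const.mul
        ((continuousOn_zpow_sphere _).mul (hent _ _))).circleIntegrable_one
    · intro z hz
      rw [abs_one] at hz
      have hz0 : z ≠ 0 := Metric.ne_of_mem_sphere hz one_ne_zero
      simp only [hP]
      rw [Finset.sum_comm, Finset.mul_sum]
      refine Finset.sum_congr rfl fun i _ => ?_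
      rw [Finset.sum_range_succ', ha0, zero_mul, add_zero, Finset.sum_mul, Finset.mul_sum]
      refine Finset.sum_congr rfl fun q _ => ?_
      have e : z ^ (p + 1) * z⁻¹ ^ (q + 1) = z ^ (-((q : ℤ) - (p : ℤ))) := by
        rw [neg_sub, zpow_sub₀ hz0, zpow_natCast, zpow_natCast, inv_pow, pow_succ, pow_succ]
        field_simp
      rw [← e]
      ring
  have hc1 : ContinuousOn (fun z => z ^ (p + 1) * ∑ i, P i z * γ z i l) (Metric.sphere 0 1) :=
    hpc.mul (continuousOn_finsetSum _ fun i _ => (hPc i).mul (hent i l))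
  have hc2 : ContinuousOn (fun z => z ^ (p + 1) * ∑ i, f i z * γ z i l) (Metric.sphere 0 1) :=
    hpc.mul (continuousOn_finsetSum _ fun i _ => (hfc i).mul (hent i l))
  have hdiff := circleAverage_fun_sub hc1.circleIntegrable_one hc2.circleIntegrable_one
  rw [hFavg, sub_zero] at hdiff
  rw [hPavg, ← hdiff]
  refine norm_circleAverage_le zero_le_one fun z hz => ?_
  rw [← mul_sub, ← Finset.sum_sub_distrib, norm_mul, norm_pow, mem_sphere_zero_iff_norm.1 hz,
    one_pow, one_mul]
  calc ‖∑ i, (P i z * γ z i l - f i z * γ z i l)‖ ≤ ∑ i, B / (1 - r) * r ^ N * ‖γ z i l‖ := by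
        refine norm_sum_le_of_le _ fun i _ => ?_
        rw [← sub_mul, norm_mul]
        gcongr
        exact hPf i z hz
    _ ≤ B / (1 - r) * r ^ N * (|Γ| + 1) := by
        rw [← Finset.mul_sum]
        gcongr
        exact hcol z hz l
    _ = _ := by ring

/-- The homogeneous Riemann–Hilbert problem has only the trivial solution if the Szegő–Widom
constant does not vanish. -/
theorem eq_zero_of_homogeneous
    (hγ : ∀ i j, AnalyticOnNhd ℂ (fun z => γ z i j) (Metric.sphere 0 1))
    (hinv : ∀ z ∈ Metric.sphere (0 : ℂ) 1, IsUnit (γ z)) {ℓ : ℝ → ℂ} (hℓ : IsLogDetBranch γ ℓ)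
    (hD : szegoWidomConstant γ ≠ 0) {F f : Fin n → ℂ → ℂ}
    (hF : ∀ i, DiffContOnCl ℂ (F i) (Metric.ball 0 1))
    (hf : ∀ i, DiffContOnCl ℂ (f i) (Metric.closedBall 0 1)ᶜ)
    (hjump : ∀ z ∈ Metric.sphere (0 : ℂ) 1, ∀ l, F l z = ∑ i, γ z i l * f i z)
    (hf0 : ∀ i, Tendsto (f i) (cocompact ℂ) (𝓝 0)) :
    (∀ i z, ‖z‖ ≤ 1 → F i z = 0) ∧ ∀ i z, 1 ≤ ‖z‖ → f i z = 0 := by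
  have hcont := continuousOn_of_analyticOnNhd hγ
  have hfc : ∀ i, ContinuousOn (f i) (Metric.sphere 0 1) := fun i => by
    refine (hf i).continuousOn.mono fun z hz => ?_
    rw [closure_compl, interior_closedBall _ one_ne_zero]
    simp [mem_sphere_zero_iff_norm.1 hz]
  obtain ⟨a, B, r, hB, hr0, hr1, hle, ha0, hsum⟩ :=
    exists_coeff_of_homogeneous hγ hinv hF hf hjump hf0
  have ha : ∀ i k, a i k = 0 := by
    by_contra! hne
    obtain ⟨i₀, k₀, hne⟩ := hne
    obtain ⟨q₀, rfl⟩ : ∃ q, k₀ = q + 1 :=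
      Nat.exists_eq_succ_of_ne_zero fun h => hne (h ▸ ha0 i₀)
    obtain ⟨C, hC, hbound⟩ := exists_norm_sum_coeff_mul_laurentCoeff_le hcont hF hfc hjump hB hr0
      hr1 hle ha0 hsum
    refine hD (tendsto_toeplitzDet_div_zero hcont hinv hℓ
      (fun q i => (a i₀ (q₀ + 1))⁻¹ * a i (q + 1)) (q₀ := q₀) (i₀ := i₀) (inv_mul_cancel₀ hne)
      (C := ‖(a i₀ (q₀ + 1))⁻¹‖ * C)
      (mul_pos (norm_pos_iff.2 (inv_ne_zero hne)) hC) hr0 hr1 fun N p l => ?_).limUnder_eq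
    simp only [mul_assoc, ← Finset.mul_sum]
    rw [norm_mul]
    gcongr
    exact hbound N p l
  have hfz : ∀ i z, 1 ≤ ‖z‖ → f i z = 0 := by
    intro i z hz
    have h := hsum i z hz
    simp only [ha, zero_mul] at h
    exact h.unique hasSum_zero
  refine ⟨fun i z hz => ?_, hfz⟩
  have h := Complex.eqOn_closure_of_eqOn_frontier (g := fun _ => (0 : ℂ)) Metric.isBounded_ball
    (hF i) diffContOnCl_const (fun w hw => ?_)
  · rw [closure_ball _ one_ne_zero] at h
    exact h (mem_closedBall_zero_iff.2 hz)
  · rw [frontier_ball _ one_ne_zero] at hw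
    rw [hjump w hw]
    exact Finset.sum_eq_zero fun j _ => by
      rw [hfz j w (mem_sphere_zero_iff_norm.1 hw).ge, mul_zero]

end HomogeneousProblem

end BlockToeplitz

theorem mainTheorem6 {n m : ℕ} (γ : ℂ → Matrix (Fin n) (Fin n) ℂ)
    (hγ : ∀ i j, AnalyticOnNhd ℂ (fun z => γ z i j) (Metric.sphere 0 1))
    (hinv : ∀ z ∈ Metric.sphere (0 : ℂ) 1, IsUnit (γ z))
    (harg : BlockToeplitz.ZeroArgVariation γ)
    (hD : BlockToeplitz.szegoWidomConstant γ ≠ 0)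
    (C : Matrix (Fin n) (Fin m) ℂ) (φp φm ψp ψm : ℂ → Matrix (Fin n) (Fin m) ℂ)
    (hφ : BlockToeplitz.IsRHSolution γ C φp φm)
    (hψ : BlockToeplitz.IsRHSolution γ C ψp ψm) :
    (∀ z : ℂ, ‖z‖ ≤ 1 → φp z = ψp z) ∧ (∀ z : ℂ, 1 ≤ ‖z‖ → φm z = ψm z) := by
  obtain ⟨ℓ, hℓ, -⟩ := harg
  have h : ∀ j : Fin m, (∀ i z, ‖z‖ ≤ 1 → φp z i j - ψp z i j = 0) ∧
      ∀ i z, 1 ≤ ‖z‖ → φm z i j - ψm z i j = 0 := by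
    intro j
    refine BlockToeplitz.eq_zero_of_homogeneous hγ hinv hℓ hD
      (F := fun i z => φp z i j - ψp z i j) (f := fun i z => φm z i j - ψm z i j)
      (fun i => (hφ.inside i j).sub (hψ.inside i j))
      (fun i => (hφ.outside i j).sub (hψ.outside i j)) (fun z hz l => ?_) (fun i => ?_)
    · simp only [hφ.jump z hz, hψ.jump z hz, Matrix.mul_apply, Matrix.transpose_apply, mul_sub,
        Finset.sum_sub_distrib]
    · simpa using (hφ.at_infinity i j).sub (hψ.at_infinity i j)
  exact ⟨fun z hz => Matrix.ext fun i j => sub_eq_zero.1 ((h j).1 i z hz),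
    fun z hz => Matrix.ext fun i j => sub_eq_zero.1 ((h j).2 i z hz)⟩
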